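/- For $n\ge 1$ let $\mathcal K^n_s$ be the class of nonempty compact convex sets $K\subset\mathbb R^n$ with $-K=K$, equipped with the Hausdorff metric. Let $o$ be the origin, $rK=\{rx:x\in K\}$, $K+L=\{x+y:x\in K,\,y\in L\}$ (Minkowski addition), let $K|S$ be the orthogonal projection of $K$ onto a linear subspace $S$, and let $\mathcal H^n$ be volume in $\mathbb R^n$. Consider an arbitrary operation $*:(\mathcal K^n_s)^2\to\mathcal K^n_s$. It - is associative if $K*(L*M)=(K*L)*M$ for all $K,L,M$; - is homogeneous of degree 1 if $(rK)*(rL)=r(K*L)$ for all $r\ge 0$ and all $K,L$; - is projection covariant if $(K*L)|S=(K|S)*(L|S)$ for all $K,L$ and all linear subspaces $S$ of $\mathbb R^n$ with $1\le\dim S\le n-1$; - is $GL(n)$ covariant if $\phi(K*L)=\phi K*\phi L$ for all $\phi\in GL(n)$ and all $K,L$; - has the identity property if $K*\{o\}=K=\{o\}*K$ for all $K$; - has polynomial volume if for all $K,L$ there are $m\in\mathbb N\cup\{0\}$ and real numbers $a_{ij}$, $0\le i,j\le m$, such that $\mathcal H^n((rK)*(sL))=\sum_{i,j=0}^{m}a_{ij}r^is^j$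 for all $r,s\ge 0$. Then: (1) If $n\ge 2$, then $*$ is projection covariant, associative and has polynomial volume if and only if one of the following holds: $K*L=\{o\}$ for all $K,L$; or $K*L=K$ for all $K,L$; or $K*L=L$ for all $K,L$; or $K*L=K+L$ for all $K,L$. (2) If $n=1$, then $*$ is homogeneous of degree 1, associative and has polynomial volume if and only if one of the same four alternatives holds. (3) If $n\ge 2$, then $*$ is continuous (with respect to the Hausdorff metric), $GL(n)$ covariant, associative, and has the identity property and polynomial volume if and only if $K*L=K+L$ for all $K,L$. -/

import Mathlib

open scoped Pointwise
open MeasureTheory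

/-- The class of nonempty compact convex sets `K` in Euclidean `n`-space with `-K = K`
(`ConvexBody` does not require interior points). As a subtype of `ConvexBody` it carries the
Hausdorff metric. -/
abbrev SymConvex (n : ℕ) : Type :=
  {K : ConvexBody (EuclideanSpace ℝ (Fin n)) // ∀ x ∈ K, -x ∈ K}

namespace SymConvex

variable {n : ℕ}

/-- The image of an `o`-symmetric compact convex set under a linear map. -/
def image (φ : EuclideanSpace ℝ (Fin n) →L[ℝ] EuclideanSpace ℝ (Fin n)) (K : SymConvex n) :
    SymConvex n :=
  ⟨⟨φ '' (K.1 : Set (EuclideanSpace ℝ (Fin n))),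
      K.1.convex.linear_image φ.toLinearMap,
      K.1.isCompact.image φ.continuous,
      K.1.nonempty.image φ⟩, by
    rintro _ ⟨y, hy, rfl⟩
    exact ⟨-y, K.2 y hy, map_neg φ y⟩⟩

/-- The orthogonal projection `K | S` of `K` onto a subspace `S`, as a subset of the whole space. -/
noncomputable def proj (S : Submodule ℝ (EuclideanSpace ℝ (Fin n))) (K : SymConvex n) :
    SymConvex n :=
  K.image S.starProjection

/-- The set `rK = {r x : x ∈ K}`. -/
def scale (r : ℝ) (K : SymConvex n) : SymConvex n :=
  ⟨r • K.1, by
    rintro _ ⟨y, hy, rfl⟩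
    exact ⟨-y, K.2 y hy, smul_neg r y⟩⟩

/-- The singleton `{o}`. -/
def origin : SymConvex n :=
  ⟨0, by
    intro x hx
    have h : x = 0 := hx
    subst h
    simpa using hx⟩

end SymConvex

/-- `K * (L * M) = (K * L) * M`. -/
def OpAssociative {n : ℕ} (op : SymConvex n → SymConvex n → SymConvex n) : Prop :=
  ∀ K L M, op K (op L M) = op (op K L) M

/-- `(rK) * (rL) = r (K * L)` for all `r ≥ 0`: homogeneity of degree 1. -/
def OpHomogeneous {n : ℕ} (op : SymConvex n → SymConvex n → SymConvex n) : Prop :=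
  ∀ r : ℝ, 0 ≤ r → ∀ K L, op (K.scale r) (L.scale r) = (op K L).scale r

/-- `K * {o} = K = {o} * K`. -/
def OpIdentity {n : ℕ} (op : SymConvex n → SymConvex n → SymConvex n) : Prop :=
  ∀ K, op K SymConvex.origin = K ∧ op SymConvex.origin K = K

/-- Joint continuity with respect to the Hausdorff metric. -/
def OpContinuous {n : ℕ} (op : SymConvex n → SymConvex n → SymConvex n) : Prop :=
  Continuous (Function.uncurry op)

/-- `φ (K * L) = φ K * φ L` for all invertible linear maps `φ`. -/
def OpGLCovariant {n : ℕ} (op : SymConvex n → SymConvex n → SymConvex n) : Prop :=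
  ∀ φ : EuclideanSpace ℝ (Fin n) ≃L[ℝ] EuclideanSpace ℝ (Fin n), ∀ K L,
    (op K L).image φ = op (K.image φ) (L.image φ)

/-- `(K * L) | S = (K | S) * (L | S)` for all subspaces `S` of dimension `1 ≤ k ≤ n - 1`. -/
def OpProjectionCovariant {n : ℕ} (op : SymConvex n → SymConvex n → SymConvex n) : Prop :=
  ∀ S : Submodule ℝ (EuclideanSpace ℝ (Fin n)),
    1 ≤ Module.finrank ℝ S → Module.finrank ℝ S < n →
      ∀ K L, (op K L).proj S = op (K.proj S) (L.proj S)

/-- For all `K, L`, the volume of `rK * sL` is a polynomial in `r, s ≥ 0`, whose degree and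
coefficients may depend on `K` and `L`. -/
def OpPolynomialVolume {n : ℕ} (op : SymConvex n → SymConvex n → SymConvex n) : Prop :=
  ∀ K L : SymConvex n, ∃ (m : ℕ) (a : ℕ → ℕ → ℝ), ∀ r s : ℝ, 0 ≤ r → 0 ≤ s →
    volume.real ((op (K.scale r) (L.scale s)).1 : Set (EuclideanSpace ℝ (Fin n))) =
      ∑ i ∈ Finset.range (m + 1), ∑ j ∈ Finset.range (m + 1), a i j * r ^ i * s ^ j

/-- `K * L = {x + y : x ∈ K, y ∈ L}` for all `K, L`. -/
def IsMinkowskiAddition {n : ℕ} (op : SymConvex n → SymConvex n → SymConvex n) : Prop :=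
  ∀ K L, (op K L).1 = K.1 + L.1

/-- The operation is one of `K * L = {o}`, `K * L = K`, `K * L = L`, `K * L = K + L`. -/
def IsTrivialOrMinkowski {n : ℕ} (op : SymConvex n → SymConvex n → SymConvex n) : Prop :=
  (∀ K L, op K L = SymConvex.origin) ∨ (∀ K L, op K L = K) ∨ (∀ K L, op K L = L) ∨
    IsMinkowskiAddition op

/-! A body is determined by its support function `h_K`. Projecting onto the line spanned by a unit
vector `u` shows that `h_{K*L}(u)` depends only on `h_K(u)` and `h_L(u)`. For `n ≥ 2`, projecting
segments back and forth between two lines shows that this dependence is homogeneous and the same for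
all `u`, so `h_{K*L} = f(h_K, h_L)` with one homogeneous `f`
(`OpProjectionCovariant.isRepresentedBy`).

Associativity forces `f(1,0)` and `f(0,1)` into `{0, 1}`. Subadditivity of the support function of a
product of two orthogonal segments gives `f(a,0), f(0,b) ≤ f(a,b) ≤ f(a,0) + f(0,b)`. Unless both
constants are 1, these facts already make `f` linear. If both are 1, a suitable `L` has `vol(r[-e,e]
* L) = f(r,1) vol(L)`, so `f(r,1)` is a polynomial between `r` and `r + 1`. Hence it is `r + 1`, and
`f(a,b) = a + b`.

In dimension one a body is a single number and homogeneity is assumed, so the volume hypothesis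
makes `f` a homogeneous polynomial of degree 1, that is, linear. For the third claim, projections
are limits of invertible maps, and the identity property rules out the trivial operations.

The converse rests on Minkowski's theorem that `vol(rK + sL)` is a polynomial. A neighbourhood of
`rK + sL` is the injective image of the gradient of a convex function, so its volume is the integral
of a Jacobian determinant. That determinant is polynomial in `r` and `s`, and the width of the
neighbourhood then tends to 0. -/

/-! ### Support functions of compact convex sets. -/

section SupportFunction

variable {E : Type*} [NormedAddCommGroup E] [InnerProductSpace ℝ E]

/-- The support function of a set. -/
noncomputable def supportFn (K : Set E) (x : E) : ℝ :=
  sSup ((fun y => inner ℝ x y) '' K)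

theorem supportFn_eq_of_mem {K : Set E} {x y : E} {c : ℝ} (hy : y ∈ K) (hc : inner ℝ x y = c)
    (h : ∀ z ∈ K, inner ℝ x z ≤ c) : supportFn K x = c := by
  refine IsGreatest.csSup_eq ⟨⟨y, hy, hc⟩, ?_⟩
  rintro _ ⟨z, hz, rfl⟩
  exact h z hz

theorem exists_isMaxOn_inner {K : Set E} (hK : IsCompact K) (hne : K.Nonempty) (x : E) :
    ∃ y ∈ K, inner ℝ x y = supportFn K x ∧ ∀ z ∈ K, inner ℝ x z ≤ supportFn K x := by
  obtain ⟨y, hy, hmax⟩ := hK.exists_isMaxOn hne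
    (f := fun y => inner ℝ x y) (by fun_prop)
  have := supportFn_eq_of_mem hy rfl (fun z hz => hmax hz)
  exact ⟨y, hy, this.symm, fun z hz => this ▸ hmax hz⟩

theorem inner_le_supportFn {K : Set E} (hK : IsCompact K) {y : E} (hy : y ∈ K) (x : E) :
    inner ℝ x y ≤ supportFn K x := by
  obtain ⟨_, _, _, h⟩ := exists_isMaxOn_inner hK ⟨y, hy⟩ x
  exact h y hy

theorem supportFn_le {K : Set E} (hne : K.Nonempty) {x : E} {c : ℝ}
    (h : ∀ z ∈ K, inner ℝ x z ≤ c) : supportFn K x ≤ c := by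
  refine csSup_le (hne.image _) ?_
  rintro _ ⟨z, hz, rfl⟩
  exact h z hz

theorem mem_of_forall_inner_le_supportFn [CompleteSpace E] {K : Set E} (hc : Convex ℝ K)
    (hK : IsCompact K) (hne : K.Nonempty) {p : E}
    (h : ∀ x, inner ℝ x p ≤ supportFn K x) : p ∈ K := by
  by_contra hp
  obtain ⟨f, u, hf, hu⟩ := geometric_hahn_banach_closed_point hc hK.isClosed hp
  have hf' : ∀ y, f y = inner ℝ ((InnerProductSpace.toDual ℝ E).symm f) y := fun y => by simp
  have h1 := h ((InnerProductSpace.toDual ℝ E).symm f)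
  have h2 : supportFn K ((InnerProductSpace.toDual ℝ E).symm f) ≤ u :=
    supportFn_le hne fun z hz => by rw [← hf']; exact (hf z hz).le
  rw [← hf'] at h1
  linarith

theorem supportFn_smul_right {K : Set E} (hK : IsCompact K) (hne : K.Nonempty) {c : ℝ}
    (hc : 0 ≤ c) (x : E) : supportFn K (c • x) = c * supportFn K x := by
  obtain ⟨y, hy, h1, h2⟩ := exists_isMaxOn_inner hK hne x
  refine supportFn_eq_of_mem hy (by rw [real_inner_smul_left, h1]) fun z hz => ?_
  rw [real_inner_smul_left]
  exact mul_le_mul_of_nonneg_left (h2 z hz) hc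

theorem supportFn_add_le {K : Set E} (hK : IsCompact K) (hne : K.Nonempty) (x y : E) :
    supportFn K (x + y) ≤ supportFn K x + supportFn K y :=
  supportFn_le hne fun z hz => by
    rw [inner_add_left]
    exact add_le_add (inner_le_supportFn hK hz x) (inner_le_supportFn hK hz y)

theorem supportFn_continuous {K : Set E} (hK : IsCompact K) (hne : K.Nonempty) :
    Continuous (supportFn K) := by
  obtain ⟨R, hR⟩ := hK.isBounded.exists_norm_le
  have hR0 : 0 ≤ R := (norm_nonneg _).trans (hR _ hne.some_mem)
  have hb : ∀ x, supportFn K x ≤ R * ‖x‖ := fun x => supportFn_le hne fun z hz =>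
    (real_inner_le_norm x z).trans (by
      rw [mul_comm]; exact mul_le_mul_of_nonneg_right (hR z hz) (norm_nonneg _))
  refine (LipschitzWith.of_le_add_mul ⟨R, hR0⟩ fun x y => ?_).continuous
  have := supportFn_add_le hK hne y (x - y)
  rw [add_sub_cancel] at this
  rw [dist_eq_norm]
  exact this.trans (add_le_add le_rfl (hb _))

theorem supportFn_smul {K : Set E} (hK : IsCompact K) (hne : K.Nonempty) {c : ℝ}
    (hc : 0 ≤ c) (x : E) : supportFn (c • K) x = c * supportFn K x := by
  obtain ⟨y, hy, h1, h2⟩ := exists_isMaxOn_inner hK hne x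
  refine supportFn_eq_of_mem (Set.smul_mem_smul_set hy) (by rw [real_inner_smul_right, h1]) ?_
  rintro _ ⟨z, hz, rfl⟩
  simp only [real_inner_smul_right]
  exact mul_le_mul_of_nonneg_left (h2 z hz) hc

theorem supportFn_add {K L : Set E} (hK : IsCompact K) (hKne : K.Nonempty) (hL : IsCompact L)
    (hLne : L.Nonempty) (x : E) : supportFn (K + L) x = supportFn K x + supportFn L x := by
  obtain ⟨y, hy, h1, h2⟩ := exists_isMaxOn_inner hK hKne x
  obtain ⟨z, hz, h3, h4⟩ := exists_isMaxOn_inner hL hLne x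
  refine supportFn_eq_of_mem (Set.add_mem_add hy hz) (by rw [inner_add_right, h1, h3]) ?_
  rintro _ ⟨a, ha, b, hb, rfl⟩
  simp only [inner_add_right]
  exact add_le_add (h2 a ha) (h4 b hb)

end SupportFunction

/-! ### Smooth convex potentials with gradients in a given body. -/

section SmoothPotential

variable {E : Type*} [NormedAddCommGroup E] [InnerProductSpace ℝ E]

theorem HasFDerivAt.hasDerivAt_comp_line {F : Type*} [NormedAddCommGroup F] [NormedSpace ℝ F]
    {f : E → F} {f' : E →L[ℝ] F} {x v : E} {t : ℝ} (hf : HasFDerivAt f f' (x + t • v)) :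
    HasDerivAt (fun t : ℝ => f (x + t • v)) (f' v) t :=
  hf.comp_hasDerivAt t (by simpa using ((hasDerivAt_id t).smul_const v).const_add x)

theorem supportFn_convexOn {K : Set E} (hK : IsCompact K) (hne : K.Nonempty) :
    ConvexOn ℝ Set.univ (supportFn K) := by
  refine ⟨convex_univ, fun x _ y _ a b ha hb _ => ?_⟩
  refine (supportFn_add_le hK hne _ _).trans_eq ?_
  rw [supportFn_smul_right hK hne ha, supportFn_smul_right hK hne hb]
  rfl

/-- Mollifying the support function keeps it convex and subadditive against `supportFn K`. The
subadditivity is what later confines the gradient to `K`; the lower bound gives coercivity. -/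
theorem exists_contDiff_approx_supportFn [FiniteDimensional ℝ E] [MeasurableSpace E] [BorelSpace E] {K : Set E}
    (hK : IsCompact K) (hne : K.Nonempty) :
    ∃ (u : E → ℝ) (c : ℝ), ContDiff ℝ 2 u ∧ ConvexOn ℝ Set.univ u ∧
      (∀ x z, u (x + z) ≤ u x + supportFn K z) ∧ ∀ x, supportFn K x - c ≤ u x := by
  let φ : ContDiffBump (0 : E) := ⟨1, 2, one_pos, one_lt_two⟩
  let ρ : E → ℝ := φ.normed volume
  have hρ0 : ∀ t, 0 ≤ ρ t := φ.nonneg_normed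
  have hρ1 : ∫ t, ρ t = 1 := φ.integral_normed
  have hρc : Continuous ρ := φ.continuous_normed
  have hρs : HasCompactSupport ρ := φ.hasCompactSupport_normed
  have hh := supportFn_continuous hK hne
  have hint : ∀ f : E → ℝ, Continuous f → Integrable fun t => ρ t * f t := fun f hf =>
    (hρc.mul hf).integrable_of_hasCompactSupport hρs.mul_right
  have hint' : ∀ x, Integrable fun t => ρ t * supportFn K (x - t) := fun x =>
    hint _ (by fun_prop)
  have hconst : ∀ c : ℝ, ∫ t, ρ t * c = c := fun c => by
    rw [integral_mul_const, hρ1, one_mul]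
  refine ⟨fun x => ∫ t, ρ t * supportFn K (x - t), ∫ t, ρ t * supportFn K t, ?_, ?_, ?_, ?_⟩
  · exact hρs.contDiff_convolution_left (ContinuousLinearMap.lsmul ℝ ℝ) (n := 2)
      φ.contDiff_normed hh.locallyIntegrable
  · refine ⟨convex_univ, fun x _ y _ a b ha hb hab => ?_⟩
    simp only [smul_eq_mul]
    rw [← integral_const_mul, ← integral_const_mul,
      ← integral_add ((hint' x).const_mul a) ((hint' y).const_mul b)]
    refine integral_mono (hint' _) (((hint' x).const_mul a).add ((hint' y).const_mul b))
      fun t => ?_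
    have h1 : a • x + b • y - t = a • (x - t) + b • (y - t) := by
      have : t = a • t + b • t := by rw [← add_smul, hab, one_smul]
      rw [smul_sub, smul_sub]
      nth_rewrite 1 [this]
      abel
    have := (supportFn_convexOn hK hne).2 (Set.mem_univ (x - t)) (Set.mem_univ (y - t)) ha hb hab
    simp only [smul_eq_mul, h1] at this ⊢
    nlinarith [mul_le_mul_of_nonneg_left this (hρ0 t)]
  · intro x z
    beta_reduce
    rw [← hconst (supportFn K z)]
    rw [← integral_add (hint' x) (hint _ continuous_const)]
    refine integral_mono (hint' _) ((hint' x).add (hint _ continuous_const)) fun t => ?_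
    have := supportFn_add_le hK hne (x - t) z
    rw [show x - t + z = x + z - t by abel] at this
    have := mul_le_mul_of_nonneg_left this (hρ0 t)
    simpa [mul_add] using this
  -- Average `h(x) ≤ h(x - t) + h(t)` against the mollifier.
  · intro x
    have h := integral_mono (hint (fun _ => supportFn K x) continuous_const)
      ((hint' x).add (hint _ hh)) fun t => by
        have := supportFn_add_le hK hne (x - t) t
        rw [sub_add_cancel] at this
        have := mul_le_mul_of_nonneg_left this (hρ0 t)
        simpa [mul_add] using this
    rw [hconst, integral_add' (hint' x) (hint _ hh)] at h
    linarith

/-- On each line the restriction of `u` is convex, so its derivative is monotone and its second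
derivative nonnegative. -/
theorem ConvexOn.inner_fderiv_gradient_nonneg {u : E → ℝ} {g : E → E} {g' : E → E →L[ℝ] E}
    (hu : ConvexOn ℝ Set.univ u) (hg : ∀ x, HasFDerivAt u (innerSL ℝ (g x)) x)
    (hg' : ∀ x, HasFDerivAt g (g' x) x) (x v : E) : 0 ≤ inner ℝ (g' x v) v := by
  have h1 : ∀ t : ℝ, HasDerivAt (fun t : ℝ => u (x + t • v)) (inner ℝ (g (x + t • v)) v) t :=
    fun t => (hg _).hasDerivAt_comp_line
  have h2 : ∀ t : ℝ, HasDerivAt (fun t : ℝ => inner ℝ (g (x + t • v)) v)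
      (inner ℝ (g' (x + t • v) v) v) t := fun t => by
    simpa using (hg' _).hasDerivAt_comp_line.inner ℝ (hasDerivAt_const t v)
  have hconv : ConvexOn ℝ Set.univ fun t : ℝ => u (x + t • v) := by
    have := hu.comp_affineMap (AffineMap.lineMap x (x + v) : ℝ →ᵃ[ℝ] E)
    simpa [Function.comp_def, AffineMap.lineMap_apply, add_comm] using this
  have hmono := hconv.monotoneOn_deriv fun t _ => (h1 t).differentiableAt
  rw [monotoneOn_univ, show deriv (fun t : ℝ => u (x + t • v)) =
    fun t => inner ℝ (g (x + t • v)) v from funext fun t => (h1 t).deriv] at hmono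
  have := hmono.deriv_nonneg (x := 0)
  rwa [(h2 0).deriv, zero_smul, add_zero] at this

theorem exists_gradient_of_contDiff [FiniteDimensional ℝ E] {u : E → ℝ} (hu : ContDiff ℝ 2 u) :
    ∃ (g : E → E) (g' : E → E →L[ℝ] E), (∀ x, HasFDerivAt u (innerSL ℝ (g x)) x) ∧
      ∀ x, HasFDerivAt g (g' x) x := by
  let T : (E →L[ℝ] ℝ) →L[ℝ] E := LinearMap.toContinuousLinearMap
    { toFun := (InnerProductSpace.toDual ℝ E).symm
      map_add' := map_add _
      map_smul' := fun c f => by simp }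
  have hT : ∀ f, innerSL ℝ (T f) = f := fun f => by
    ext v
    simp [T]
  have h2 : Differentiable ℝ (fderiv ℝ u) :=
    (hu.fderiv_right (m := 1) (by norm_num)).differentiable (by norm_num)
  refine ⟨fun x => T (fderiv ℝ u x), fun x => T ∘L fderiv ℝ (fderiv ℝ u) x, fun x => ?_,
    fun x => T.hasFDerivAt.comp x (h2 x).hasFDerivAt⟩
  rw [hT]
  exact (hu.differentiable (by norm_num) x).hasFDerivAt

/-- A smooth convex function at bounded distance above `supportFn K - c` whose gradient takes its
values in `K`. -/
theorem exists_convex_potential [FiniteDimensional ℝ E] {K : Set E} (hc : Convex ℝ K) (hK : IsCompact K)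
    (hne : K.Nonempty) :
    ∃ (u : E → ℝ) (g : E → E) (g' : E → E →L[ℝ] E) (c : ℝ),
      (∀ x, HasFDerivAt u (innerSL ℝ (g x)) x) ∧ (∀ x, HasFDerivAt g (g' x) x) ∧
      (∀ x v, 0 ≤ inner ℝ (g' x v) v) ∧ (∀ x, g x ∈ K) ∧ ∀ x, supportFn K x - c ≤ u x := by
  let _ : MeasurableSpace E := borel E
  have _ : BorelSpace E := ⟨rfl⟩
  obtain ⟨u, c, hu, hconv, hsub, hlow⟩ := exists_contDiff_approx_supportFn hK hne
  obtain ⟨g, g', hg, hg'⟩ := exists_gradient_of_contDiff hu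
  refine ⟨u, g, g', c, hg, hg', hconv.inner_fderiv_gradient_nonneg hg hg', fun x => ?_, hlow⟩
  refine mem_of_forall_inner_le_supportFn hc hK hne fun v => ?_
  have hd : HasDerivAt (fun t : ℝ => u (x + t • v)) (inner ℝ (g x) v) 0 :=
    HasFDerivAt.hasDerivAt_comp_line (f' := innerSL ℝ (g x)) (by simpa using hg x)
  rw [real_inner_comm]
  -- Every right difference quotient of `u` in direction `v` is at most `supportFn K v`.
  refine le_of_tendsto hd.tendsto_slope_zero_right ?_
  filter_upwards [self_mem_nhdsWithin] with t (ht : 0 < t)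
  have h1 := hsub x (t • v)
  rw [supportFn_smul_right hK hne ht.le] at h1
  simp only [zero_add, zero_smul, add_zero, smul_eq_mul]
  rw [inv_mul_le_iff₀ ht]
  linarith

/-- The segment from the identity to `A` consists of invertible maps, so the determinant cannot
change sign along it. -/
theorem ContinuousLinearMap.det_pos_of_inner_pos [FiniteDimensional ℝ E] {A : E →L[ℝ] E}
    (hA : ∀ v, v ≠ 0 → 0 < inner ℝ (A v) v) : 0 < A.det := by
  have hne : ∀ t ∈ Set.Icc (0 : ℝ) 1,
      LinearMap.det ((t • A + (1 - t) • ContinuousLinearMap.id ℝ E : E →L[ℝ] E) : E →ₗ[ℝ] E) ≠ 0 := by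
    intro t ht h0
    obtain ⟨v, hv, hv0⟩ := SetLike.exists_of_lt (LinearMap.bot_lt_ker_of_det_eq_zero h0)
    have h1 : t • A v + (1 - t) • v = 0 := by simpa using hv
    have hv0 : v ≠ 0 := by simpa using hv0
    have h2 : t * inner ℝ (A v) v + (1 - t) * inner ℝ v v = 0 := by
      rw [← real_inner_smul_left, ← real_inner_smul_left, ← inner_add_left, h1, inner_zero_left]
    have h3 := hA v hv0
    have h4 : 0 < inner ℝ v v := real_inner_self_pos.2 hv0
    rcases ht.1.eq_or_lt with rfl | hpos
    · simp at h2; exact hv0 h2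
    · nlinarith [mul_pos hpos h3, mul_nonneg (sub_nonneg.2 ht.2) h4.le]
  have hcont : Continuous fun t : ℝ =>
      (t • A + (1 - t) • ContinuousLinearMap.id ℝ E : E →L[ℝ] E).det :=
    ContinuousLinearMap.continuous_det.comp (by fun_prop)
  by_contra! h
  obtain ⟨t, ht, h0⟩ := intermediate_value_Icc' (zero_le_one' ℝ) hcont.continuousOn
    (show (0 : ℝ) ∈ Set.Icc _ _ by
      constructor
      · simpa using h
      · have : (ContinuousLinearMap.id ℝ E).det = 1 := LinearMap.det_id
        simp [this])
  exact hne t ht h0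

/-- Along the segment from `x` to `y` the component of `G` in direction `y - x` is strictly
increasing. -/
theorem injective_of_inner_fderiv_pos {G : E → E} {G' : E → E →L[ℝ] E}
    (hG : ∀ x, HasFDerivAt G (G' x) x) (hpos : ∀ x v, v ≠ 0 → 0 < inner ℝ (G' x v) v) :
    Function.Injective G := by
  intro x y hxy
  by_contra hne
  set v := y - x with hv
  have hv0 : v ≠ 0 := sub_ne_zero.2 (Ne.symm hne)
  have h2 : ∀ t : ℝ, HasDerivAt (fun t : ℝ => inner ℝ (G (x + t • v)) v)
      (inner ℝ (G' (x + t • v) v) v) t := fun t => by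
    simpa using (hG _).hasDerivAt_comp_line.inner ℝ (hasDerivAt_const t v)
  have hmono : StrictMono fun t : ℝ => inner ℝ (G (x + t • v)) v :=
    strictMono_of_hasDerivAt_pos h2 fun t => hpos _ _ hv0
  have := hmono (zero_lt_one' ℝ)
  simp [hv, hxy] at this

end SmoothPotential

/-! ### Minkowski's theorem on the volume of `r • K + s • L`. -/

section MinkowskiPolynomial

open scoped InnerProductSpace

/-- The function `√(1 + ‖x‖²)` works, with positivity by Cauchy–Schwarz. Its strictly positive
Hessian makes the combined Jacobian invertible once it enters with a factor `ε > 0`. -/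
theorem exists_unit_ball_potential (E : Type*) [NormedAddCommGroup E] [InnerProductSpace ℝ E] :
    ∃ (u : E → ℝ) (g : E → E) (g' : E → E →L[ℝ] E),
      (∀ x, HasFDerivAt u (innerSL ℝ (g x)) x) ∧ (∀ x, HasFDerivAt g (g' x) x) ∧
      (∀ x v, v ≠ 0 → 0 < inner ℝ (g' x v) v) ∧ (∀ x, ‖g x‖ < 1) ∧ ∀ x, ‖x‖ ≤ u x := by
  have hpos : ∀ x : E, 0 < 1 + ‖x‖ ^ 2 := fun x => by positivity
  have hs : ∀ x : E, 0 < √(1 + ‖x‖ ^ 2) := fun x => Real.sqrt_pos.2 (hpos x)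
  have hlt : ∀ x : E, ‖x‖ < √(1 + ‖x‖ ^ 2) := fun x =>
    Real.lt_sqrt_of_sq_lt (by linarith)
  have hu : ∀ x : E, HasFDerivAt (fun x : E => √(1 + ‖x‖ ^ 2))
      (innerSL ℝ ((√(1 + ‖x‖ ^ 2))⁻¹ • x)) x := fun x => by
    have h := (((hasStrictFDerivAt_norm_sq x).hasFDerivAt).const_add 1).sqrt (hpos x).ne'
    refine h.congr_fderiv ?_
    ext v
    have := (hs x).ne'
    simp
    field_simp
  refine ⟨fun x => √(1 + ‖x‖ ^ 2), fun x => (√(1 + ‖x‖ ^ 2))⁻¹ • x, _, hu,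
    fun x => ((hasFDerivAt_inv (hs x).ne').comp x (hu x)).smul (hasFDerivAt_id x),
    fun x v hv => ?_, fun x => ?_, fun x => (hlt x).le⟩
  · have h1 : ⟪x, v⟫_ℝ ^ 2 ≤ ‖x‖ ^ 2 * ‖v‖ ^ 2 := by
      rw [← mul_pow]
      exact sq_le_sq' (neg_le_of_abs_le (abs_real_inner_le_norm x v)) (real_inner_le_norm x v)
    have h2 : 0 < ‖v‖ ^ 2 := by positivity
    have h3 := Real.sq_sqrt (hpos x).le
    have h4 := hs x
    set s := √(1 + ‖x‖ ^ 2)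
    simp [inner_add_left, real_inner_smul_left]
    have h5 : s⁻¹ * ‖v‖ ^ 2 - s⁻¹ * (⟪x, v⟫_ℝ * (s ^ 2)⁻¹) * ⟪x, v⟫_ℝ =
        s⁻¹ ^ 3 * (s ^ 2 * ‖v‖ ^ 2 - ⟪x, v⟫_ℝ ^ 2) := by
      field_simp
    rw [← sub_pos, h5, h3]
    exact mul_pos (by positivity) (by linarith)
  · rw [norm_smul, norm_inv, Real.norm_of_nonneg (hs x).le, inv_mul_lt_iff₀ (hs x), mul_one]
    exact hlt x

variable {E : Type*} [NormedAddCommGroup E] [InnerProductSpace ℝ E] [FiniteDimensional ℝ E]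

/-- The volume of a thickening of `r • K + s • L` as the integral of the Jacobian determinant of
the gradient of a convex function. -/
theorem exists_integral_det_eq_measureReal_thickening [MeasurableSpace E] [BorelSpace E]
    {K L : Set E} (hKc : Convex ℝ K) (hK : IsCompact K) (hKne : K.Nonempty)
    (hLc : Convex ℝ L) (hL : IsCompact L) (hLne : L.Nonempty) :
    ∃ A B C : E → E →L[ℝ] E, ∀ r s ε : ℝ, 0 ≤ r → 0 ≤ s → 0 < ε →
      Integrable (fun x => (r • A x + s • B x + ε • C x).det) ∧
      ∫ x, (r • A x + s • B x + ε • C x).det =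
        volume.real (Metric.thickening ε (r • K + s • L)) := by
  obtain ⟨u₁, g₁, A, c₁, hu₁, hg₁, hA, hgK, hc₁⟩ := exists_convex_potential hKc hK hKne
  obtain ⟨u₂, g₂, B, c₂, hu₂, hg₂, hB, hgL, hc₂⟩ := exists_convex_potential hLc hL hLne
  obtain ⟨u₃, g₃, C, hu₃, hg₃, hC, hgb, hc₃⟩ := exists_unit_ball_potential E
  refine ⟨A, B, C, fun r s ε hr hs hε => ?_⟩
  have hG : ∀ x, HasFDerivAt (fun x => r • g₁ x + s • g₂ x + ε • g₃ x)
      (r • A x + s • B x + ε • C x) x := fun x =>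
    (((hg₁ x).const_smul r).add ((hg₂ x).const_smul s)).add ((hg₃ x).const_smul ε)
  have hpos : ∀ x v, v ≠ 0 → 0 < ⟪(r • A x + s • B x + ε • C x) v, v⟫_ℝ := fun x v hv => by
    simp only [add_apply, smul_apply, inner_add_left,
      real_inner_smul_left]
    have := mul_nonneg hr (hA x v)
    have := mul_nonneg hs (hB x v)
    have := mul_pos hε (hC x v hv)
    linarith
  have hdet : ∀ x, |(r • A x + s • B x + ε • C x).det| = (r • A x + s • B x + ε • C x).det :=
    fun x => abs_of_pos (ContinuousLinearMap.det_pos_of_inner_pos (hpos x))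
  have hcpt : IsCompact (r • K + s • L) := (hK.smul r).add (hL.smul s)
  have himage : (fun x => r • g₁ x + s • g₂ x + ε • g₃ x) '' Set.univ =
      Metric.thickening ε (r • K + s • L) := by
    ext p
    rw [Set.image_univ, Metric.mem_thickening_iff]
    constructor
    · rintro ⟨x, rfl⟩
      refine ⟨r • g₁ x + s • g₂ x, Set.add_mem_add (Set.smul_mem_smul_set (hgK x))
        (Set.smul_mem_smul_set (hgL x)), ?_⟩
      rw [dist_eq_norm, add_sub_cancel_left, norm_smul, Real.norm_of_nonneg hε.le]
      exact mul_lt_of_lt_one_right hε (hgb x)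
    · rintro ⟨_, ⟨_, ⟨a, ha, rfl⟩, _, ⟨b, hb, rfl⟩, rfl⟩, hpq⟩
      -- A critical point of `w` is a preimage of `p`. As `p` is closer than `ε` to a point of `r •
      -- K + s • L`, `w` grows at least linearly and attains its minimum.
      set w : E → ℝ := fun x => r * u₁ x + s * u₂ x + ε * u₃ x - ⟪p, x⟫_ℝ with hw
      have hw' : ∀ x, HasFDerivAt w
          (r • innerSL ℝ (g₁ x) + s • innerSL ℝ (g₂ x) + ε • innerSL ℝ (g₃ x) - innerSL ℝ p) x :=
        fun x => ((((hu₁ x).const_mul r).add ((hu₂ x).const_mul s)).add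
          ((hu₃ x).const_mul ε)).sub (innerSL ℝ p).hasFDerivAt
      have hwc : Continuous w := continuous_iff_continuousAt.2 fun x => (hw' x).continuousAt
      have hlow : ∀ x, (ε - dist p (r • a + s • b)) * ‖x‖ - (r * c₁ + s * c₂) ≤ w x := fun x => by
        have h1 := mul_le_mul_of_nonneg_left
          ((sub_le_sub_right (inner_le_supportFn hK ha x) c₁).trans (hc₁ x)) hr
        have h2 := mul_le_mul_of_nonneg_left
          ((sub_le_sub_right (inner_le_supportFn hL hb x) c₂).trans (hc₂ x)) hs
        have h3 := mul_le_mul_of_nonneg_left (hc₃ x) hε.le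
        have h4 := real_inner_le_norm (p - (r • a + s • b)) x
        rw [inner_sub_left, inner_add_left, real_inner_smul_left, real_inner_smul_left,
          real_inner_comm x a, real_inner_comm x b, ← dist_eq_norm] at h4
        simp only [hw]
        nlinarith
      obtain ⟨x, hx⟩ := hwc.exists_forall_le' 0 (by
        have ht : Filter.Tendsto (fun x : E => (ε - dist p (r • a + s • b)) * ‖x‖ -
            (r * c₁ + s * c₂)) (Filter.cocompact E) Filter.atTop :=
          Filter.tendsto_atTop_add_const_right _ _
            ((tendsto_norm_cocompact_atTop (E := E)).const_mul_atTop (sub_pos.2 hpq))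
        exact (Filter.tendsto_atTop_mono hlow ht).eventually_ge_atTop _)
      refine ⟨x, ?_⟩
      have h0 := (show IsLocalMin w x from Filter.Eventually.of_forall hx).hasFDerivAt_eq_zero (hw' x)
      refine ext_inner_right ℝ fun v => ?_
      have := DFunLike.congr_fun h0 v
      simp at this
      simp only [inner_add_left, real_inner_smul_left]
      linarith
  have hinj := (injective_of_inner_fderiv_pos hG hpos).injOn (s := Set.univ)
  have hfin : volume (Metric.thickening ε (r • K + s • L)) ≠ ⊤ :=
    hcpt.isBounded.thickening.measure_lt_top.ne
  have hG' := fun x (_ : x ∈ Set.univ) => (hG x).hasFDerivWithinAt (s := Set.univ)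
  constructor
  -- Change of variables for the constant 1: integrability is the finiteness of the volume of the
  -- image.
  · have := (integrableOn_image_iff_integrableOn_abs_det_fderiv_smul volume MeasurableSet.univ hG'
      hinj (fun _ => (1 : ℝ))).1 (by rw [himage]; exact integrableOn_const hfin)
    simpa [hdet] using this
  · have := integral_image_eq_integral_abs_det_fderiv_smul volume MeasurableSet.univ hG'
      hinj (fun _ => (1 : ℝ))
    rw [himage] at this
    simpa [hdet] using this.symm

/-- The Lagrange basis polynomials for the nodes `0, 1, …, d`. -/
noncomputable def natLagrange (d i : ℕ) : Polynomial ℝ :=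
  Lagrange.basis (Finset.range (d + 1)) (fun k : ℕ => (k : ℝ)) i

theorem natLagrange_natDegree_lt {d i : ℕ} (hi : i ∈ Finset.range (d + 1)) :
    (natLagrange d i).natDegree < d + 1 := by
  rw [natLagrange, Lagrange.natDegree_basis Nat.cast_injective.injOn hi]
  simp

/-- The determinant has degree at most the dimension in `r`, so its values at `0, 1, …, d` determine
it. Interpolating uses only determinants already known to be integrable, not individual
coefficients. -/
theorem det_smul_add_eq_sum_natLagrange (A C : E →L[ℝ] E) (r : ℝ) :
    (r • A + C).det = ∑ i ∈ Finset.range (Module.finrank ℝ E + 1),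
      (natLagrange (Module.finrank ℝ E) i).eval r * ((i : ℝ) • A + C).det := by
  let b := Module.finBasis ℝ E
  let a := LinearMap.toMatrix b b (A : E →ₗ[ℝ] E)
  let c := LinearMap.toMatrix b b (C : E →ₗ[ℝ] E)
  let q : Polynomial ℝ := ((Polynomial.X : Polynomial ℝ) • a.map Polynomial.C + c.map Polynomial.C).det
  have hq : ∀ t : ℝ, q.eval t = (t • A + C).det := fun t => by
    have : (t • A + C).det = (t • a + c).det := by
      rw [ContinuousLinearMap.det, ← LinearMap.det_toMatrix b]
      simp [a, c]
    rw [this, ← Polynomial.coe_evalRingHom, RingHom.map_det]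
    congr 1
    ext i j
    simpa using mul_comm _ _
  have hdeg : q.degree < (Finset.range (Module.finrank ℝ E + 1)).card := by
    rw [Finset.card_range]
    refine Polynomial.degree_le_natDegree.trans_lt (Nat.cast_lt.2 (Nat.lt_succ_of_le ?_))
    simpa using Polynomial.natDegree_det_X_add_C_le a c
  have h := Lagrange.eq_interpolate (v := fun k : ℕ => (k : ℝ)) Nat.cast_injective.injOn hdeg
  rw [← hq, h, Lagrange.interpolate_apply, Polynomial.eval_finsetSum]
  refine Finset.sum_congr rfl fun i _ => ?_
  rw [Polynomial.eval_mul, Polynomial.eval_C, hq, mul_comm, natLagrange]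

/-- **Minkowski**: the volume of `r • K + s • L` is a polynomial in `r, s ≥ 0`. -/
theorem exists_measureReal_smul_add_smul_eq_polynomial [MeasurableSpace E] [BorelSpace E]
    {K L : Set E} (hKc : Convex ℝ K) (hK : IsCompact K) (hKne : K.Nonempty)
    (hLc : Convex ℝ L) (hL : IsCompact L) (hLne : L.Nonempty) :
    ∃ (m : ℕ) (a : ℕ → ℕ → ℝ), ∀ r s : ℝ, 0 ≤ r → 0 ≤ s → volume.real (r • K + s • L) =
      ∑ i ∈ Finset.range (m + 1), ∑ j ∈ Finset.range (m + 1), a i j * r ^ i * s ^ j := by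
  obtain ⟨A, B, C, hABC⟩ :=
    exists_integral_det_eq_measureReal_thickening hKc hK hKne hLc hL hLne
  set d := Module.finrank ℝ E with hd
  have hdet : ∀ (r s ε : ℝ) x, (r • A x + s • B x + ε • C x).det =
      ∑ i ∈ Finset.range (d + 1), ∑ j ∈ Finset.range (d + 1), (natLagrange d i).eval r *
        ((natLagrange d j).eval s * ((i : ℝ) • A x + (j : ℝ) • B x + ε • C x).det) := by
    intro r s ε x
    rw [add_assoc, det_smul_add_eq_sum_natLagrange]
    refine Finset.sum_congr rfl fun i _ => ?_
    rw [add_left_comm, det_smul_add_eq_sum_natLagrange, Finset.mul_sum]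
    refine Finset.sum_congr rfl fun j _ => ?_
    rw [add_left_comm, add_assoc]
  have hthick : ∀ r s ε : ℝ, 0 ≤ r → 0 ≤ s → 0 < ε →
      volume.real (Metric.thickening ε (r • K + s • L)) =
      ∑ i ∈ Finset.range (d + 1), ∑ j ∈ Finset.range (d + 1), (natLagrange d i).eval r *
        ((natLagrange d j).eval s *
          volume.real (Metric.thickening ε ((i : ℝ) • K + (j : ℝ) • L))) := by
    intro r s ε hr hs hε
    have hint : ∀ i j : ℕ, Integrable fun x => (natLagrange d i).eval r *
        ((natLagrange d j).eval s * ((i : ℝ) • A x + (j : ℝ) • B x + ε • C x).det) := fun i j =>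
      ((hABC i j ε i.cast_nonneg j.cast_nonneg hε).1.const_mul _).const_mul _
    rw [← (hABC r s ε hr hs hε).2]
    simp_rw [hdet r s]
    rw [integral_finsetSum _ fun i _ => integrable_finsetSum _ fun j _ => hint i j]
    refine Finset.sum_congr rfl fun i _ => ?_
    rw [integral_finsetSum _ fun j _ => hint i j]
    refine Finset.sum_congr rfl fun j _ => ?_
    rw [integral_const_mul, integral_const_mul, (hABC i j ε i.cast_nonneg j.cast_nonneg hε).2]
  -- Volumes of thickenings decrease to the volume of a compact set, which removes `ε`.
  have hlim : ∀ r s : ℝ, Filter.Tendsto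
      (fun ε => volume.real (Metric.thickening ε (r • K + s • L))) (nhdsWithin 0 (Set.Ioi 0))
      (nhds (volume.real (r • K + s • L))) := fun r s => by
    have hcpt : IsCompact (r • K + s • L) := (hK.smul r).add (hL.smul s)
    exact (ENNReal.tendsto_toReal hcpt.measure_lt_top.ne).comp
      (tendsto_measure_thickening_of_isClosed
        ⟨1, one_pos, hcpt.isBounded.thickening.measure_lt_top.ne⟩ hcpt.isClosed)
  have hvol : ∀ r s : ℝ, 0 ≤ r → 0 ≤ s → volume.real (r • K + s • L) =
      ∑ i ∈ Finset.range (d + 1), ∑ j ∈ Finset.range (d + 1), (natLagrange d i).eval r *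
        ((natLagrange d j).eval s * volume.real ((i : ℝ) • K + (j : ℝ) • L)) := by
    intro r s hr hs
    refine tendsto_nhds_unique ((hlim r s).congr' ?_)
      (tendsto_finsetSum _ fun (i : ℕ) _ => tendsto_finsetSum _ fun (j : ℕ) _ =>
        ((hlim i j).const_mul _).const_mul _)
    filter_upwards [self_mem_nhdsWithin] with ε hε using hthick r s ε hr hs hε
  refine ⟨d, fun k l => ∑ i ∈ Finset.range (d + 1), ∑ j ∈ Finset.range (d + 1),
    (natLagrange d i).coeff k * (natLagrange d j).coeff l *
      volume.real ((i : ℝ) • K + (j : ℝ) • L), fun r s hr hs => ?_⟩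
  rw [hvol r s hr hs]
  have heval : ∀ i ∈ Finset.range (d + 1), ∀ t : ℝ, (natLagrange d i).eval t =
      ∑ k ∈ Finset.range (d + 1), (natLagrange d i).coeff k * t ^ k := fun i hi t =>
    Polynomial.eval_eq_sum_range' (natLagrange_natDegree_lt hi) t
  calc _ = ∑ i ∈ Finset.range (d + 1), ∑ j ∈ Finset.range (d + 1), ∑ k ∈ Finset.range (d + 1),
        ∑ l ∈ Finset.range (d + 1), (natLagrange d i).coeff k * (natLagrange d j).coeff l *
          volume.real ((i : ℝ) • K + (j : ℝ) • L) * r ^ k * s ^ l := by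
        refine Finset.sum_congr rfl fun i hi => Finset.sum_congr rfl fun j hj => ?_
        rw [heval i hi, heval j hj, Finset.sum_mul]
        refine Finset.sum_congr rfl fun k _ => ?_
        rw [Finset.sum_mul, Finset.mul_sum]
        exact Finset.sum_congr rfl fun l _ => by ring
    _ = _ := by
        simp_rw [Finset.sum_mul]
        rw [Finset.sum_congr rfl fun i _ => Finset.sum_comm, Finset.sum_comm]
        refine Finset.sum_congr rfl fun k _ => ?_
        rw [Finset.sum_congr rfl fun i _ => Finset.sum_comm, Finset.sum_comm]

end MinkowskiPolynomial

/-! ### Calculus of symmetric bodies through their support functions. -/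

namespace SymConvex

variable {n : ℕ}

/-- The support function of an `o`-symmetric compact convex set. -/
noncomputable def supp (K : SymConvex n) (x : EuclideanSpace ℝ (Fin n)) : ℝ :=
  supportFn (K.1 : Set (EuclideanSpace ℝ (Fin n))) x

theorem inner_le_supp (K : SymConvex n) {y : EuclideanSpace ℝ (Fin n)} (hy : y ∈ K.1)
    (x : EuclideanSpace ℝ (Fin n)) : inner ℝ x y ≤ K.supp x :=
  inner_le_supportFn K.1.isCompact hy x

theorem subset_of_supp_le {K L : SymConvex n} (h : ∀ x, K.supp x ≤ L.supp x) :
    (K.1 : Set (EuclideanSpace ℝ (Fin n))) ⊆ L.1 := fun _ hp =>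
  mem_of_forall_inner_le_supportFn L.1.convex L.1.isCompact L.1.nonempty fun x =>
    (K.inner_le_supp hp x).trans (h x)

theorem eq_of_supp_eq {K L : SymConvex n} (h : ∀ x, K.supp x = L.supp x) : K = L :=
  Subtype.ext (ConvexBody.ext ((subset_of_supp_le fun x => (h x).le).antisymm
    (subset_of_supp_le fun x => (h x).ge)))

theorem zero_mem (K : SymConvex n) : (0 : EuclideanSpace ℝ (Fin n)) ∈ K.1 :=
  K.1.zero_mem_of_symmetric K.2

theorem supp_nonneg (K : SymConvex n) (x : EuclideanSpace ℝ (Fin n)) : 0 ≤ K.supp x := by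
  simpa using K.inner_le_supp K.zero_mem x

theorem supp_add_le (K : SymConvex n) (x y : EuclideanSpace ℝ (Fin n)) :
    K.supp (x + y) ≤ K.supp x + K.supp y :=
  supportFn_add_le K.1.isCompact K.1.nonempty x y

theorem supp_smul_of_nonneg (K : SymConvex n) {c : ℝ} (hc : 0 ≤ c)
    (x : EuclideanSpace ℝ (Fin n)) : K.supp (c • x) = c * K.supp x :=
  supportFn_smul_right K.1.isCompact K.1.nonempty hc x

theorem supp_image (φ : EuclideanSpace ℝ (Fin n) →L[ℝ] EuclideanSpace ℝ (Fin n))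
    (K : SymConvex n) (x : EuclideanSpace ℝ (Fin n)) :
    (K.image φ).supp x = K.supp (ContinuousLinearMap.adjoint φ x) := by
  obtain ⟨y, hy, h1, h2⟩ := exists_isMaxOn_inner K.1.isCompact K.1.nonempty
    (ContinuousLinearMap.adjoint φ x)
  refine supportFn_eq_of_mem (y := φ y) ⟨y, hy, rfl⟩ ?_ ?_
  · rw [← ContinuousLinearMap.adjoint_inner_left, h1, supp]
  · rintro _ ⟨z, hz, rfl⟩
    rw [← ContinuousLinearMap.adjoint_inner_left]
    exact h2 z hz

theorem supp_neg (K : SymConvex n) (x : EuclideanSpace ℝ (Fin n)) : K.supp (-x) = K.supp x := by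
  have h : ∀ x, K.supp (-x) ≤ K.supp x := fun x => supportFn_le K.1.nonempty fun z hz => by
    rw [inner_neg_left, ← inner_neg_right]
    exact K.inner_le_supp (K.2 z hz) x
  exact (h x).antisymm (by simpa using h (-x))

theorem supp_smul (K : SymConvex n) (c : ℝ) (x : EuclideanSpace ℝ (Fin n)) :
    K.supp (c • x) = |c| * K.supp x := by
  rcases le_total 0 c with hc | hc
  · rw [supp_smul_of_nonneg K hc, abs_of_nonneg hc]
  · rw [← supp_neg, ← neg_smul, supp_smul_of_nonneg K (neg_nonneg.2 hc), abs_of_nonpos hc]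

theorem supp_proj (S : Submodule ℝ (EuclideanSpace ℝ (Fin n))) (K : SymConvex n)
    (x : EuclideanSpace ℝ (Fin n)) : (K.proj S).supp x = K.supp (S.starProjection x) := by
  rw [proj, supp_image, ← ContinuousLinearMap.star_eq_adjoint,
    (isSelfAdjoint_starProjection S).star_eq]

theorem supp_scale {r : ℝ} (hr : 0 ≤ r) (K : SymConvex n) (x : EuclideanSpace ℝ (Fin n)) :
    (K.scale r).supp x = r * K.supp x :=
  supportFn_smul K.1.isCompact K.1.nonempty hr x

@[simp]
theorem supp_origin (x : EuclideanSpace ℝ (Fin n)) : (origin : SymConvex n).supp x = 0 :=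
  supportFn_eq_of_mem (y := 0) rfl (inner_zero_right x) fun z hz => by
    rw [show z = 0 from hz, inner_zero_right]

/-- Minkowski addition of `o`-symmetric compact convex sets. -/
def add (K L : SymConvex n) : SymConvex n :=
  ⟨K.1 + L.1, by
    rintro _ ⟨x, hx, y, hy, rfl⟩
    exact ⟨-x, K.2 x hx, -y, L.2 y hy, (neg_add x y).symm⟩⟩

theorem supp_add (K L : SymConvex n) (x : EuclideanSpace ℝ (Fin n)) :
    (K.add L).supp x = K.supp x + L.supp x :=
  supportFn_add K.1.isCompact K.1.nonempty L.1.isCompact L.1.nonempty x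

/-- The segment from `-v` to `v`. -/
def seg (v : EuclideanSpace ℝ (Fin n)) : SymConvex n :=
  ⟨⟨(fun t : ℝ => t • v) '' Set.Icc (-1) 1,
      (convex_Icc (-1) 1).linear_image (LinearMap.toSpanSingleton ℝ _ v),
      isCompact_Icc.image (by fun_prop),
      (Set.nonempty_Icc.2 (by norm_num)).image _⟩, by
    rintro _ ⟨t, ht, rfl⟩
    exact ⟨-t, ⟨by linarith [ht.2], by linarith [ht.1]⟩, neg_smul t v⟩⟩

@[simp]
theorem supp_seg (v x : EuclideanSpace ℝ (Fin n)) : (seg v).supp x = |inner ℝ v x| := by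
  have hle : ∀ z ∈ ((seg v).1 : Set (EuclideanSpace ℝ (Fin n))), inner ℝ x z ≤ |inner ℝ v x| := by
    rintro _ ⟨t, ht, rfl⟩
    simp only [real_inner_smul_right, real_inner_comm]
    refine (le_abs_self _).trans ?_
    rw [abs_mul]
    exact mul_le_of_le_one_left (abs_nonneg _) (abs_le.2 ht)
  rcases abs_choice (inner ℝ v x) with h | h
  · exact supportFn_eq_of_mem (y := v) ⟨1, by norm_num, one_smul ℝ v⟩
      (by rw [h, real_inner_comm]) hle
  · exact supportFn_eq_of_mem (y := -v) ⟨-1, by norm_num, by simp⟩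
      (by rw [h, real_inner_comm, inner_neg_left]) hle

/-- The closed unit ball. -/
def unitBall (n : ℕ) : SymConvex n :=
  ⟨⟨Metric.closedBall 0 1, convex_closedBall 0 1, isCompact_closedBall 0 1,
      Metric.nonempty_closedBall.2 zero_le_one⟩, fun x hx => by
    have : x ∈ Metric.closedBall (0 : EuclideanSpace ℝ (Fin n)) 1 := hx
    change -x ∈ Metric.closedBall (0 : EuclideanSpace ℝ (Fin n)) 1
    simpa using this⟩

@[simp]
theorem supp_unitBall (x : EuclideanSpace ℝ (Fin n)) : (unitBall n).supp x = ‖x‖ := by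
  refine supportFn_eq_of_mem (y := ‖x‖⁻¹ • x) ?_ ?_ fun z hz => ?_
  · change _ ∈ Metric.closedBall (0 : EuclideanSpace ℝ (Fin n)) 1
    rw [mem_closedBall_zero_iff, norm_smul, norm_inv, norm_norm]
    exact inv_mul_le_one
  · rw [real_inner_smul_right, real_inner_self_eq_norm_sq]
    rcases eq_or_ne ‖x‖ 0 with h | h
    · simp [h]
    · field_simp
  · have hz : z ∈ Metric.closedBall (0 : EuclideanSpace ℝ (Fin n)) 1 := hz
    rw [mem_closedBall_zero_iff] at hz
    exact (real_inner_le_norm x z).trans (mul_le_of_le_one_right (norm_nonneg x) hz)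

theorem scale_add (r : ℝ) (K L : SymConvex n) :
    (K.add L).scale r = (K.scale r).add (L.scale r) :=
  Subtype.ext (ConvexBody.ext (smul_add r (K.1 : Set (EuclideanSpace ℝ (Fin n))) L.1))

theorem image_add (φ : EuclideanSpace ℝ (Fin n) →L[ℝ] EuclideanSpace ℝ (Fin n))
    (K L : SymConvex n) : (K.add L).image φ = (K.image φ).add (L.image φ) :=
  eq_of_supp_eq fun x => by simp only [supp_image, supp_add]

theorem image_origin (φ : EuclideanSpace ℝ (Fin n) →L[ℝ] EuclideanSpace ℝ (Fin n)) :
    (origin : SymConvex n).image φ = origin :=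
  eq_of_supp_eq fun x => by simp only [supp_image, supp_origin]

theorem scale_origin {r : ℝ} (hr : 0 ≤ r) : (origin : SymConvex n).scale r = origin :=
  eq_of_supp_eq fun x => by simp [supp_scale hr]

theorem add_origin (K : SymConvex n) : K.add origin = K :=
  eq_of_supp_eq fun x => by simp [supp_add]

theorem origin_add (K : SymConvex n) : origin.add K = K :=
  eq_of_supp_eq fun x => by simp [supp_add]

theorem add_assoc (K L M : SymConvex n) : K.add (L.add M) = (K.add L).add M :=
  eq_of_supp_eq fun x => by simp only [supp_add, _root_.add_assoc]

theorem exists_volume_add_polynomial (K L : SymConvex n) :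
    ∃ (m : ℕ) (a : ℕ → ℕ → ℝ), ∀ r s : ℝ, 0 ≤ r → 0 ≤ s →
      volume.real (((K.scale r).add (L.scale s)).1 : Set (EuclideanSpace ℝ (Fin n))) =
      ∑ i ∈ Finset.range (m + 1), ∑ j ∈ Finset.range (m + 1), a i j * r ^ i * s ^ j :=
  exists_measureReal_smul_add_smul_eq_polynomial K.1.convex K.1.isCompact K.1.nonempty
    L.1.convex L.1.isCompact L.1.nonempty

end SymConvex

/-! ### The four operations have all the stated properties. -/

section Converse

open SymConvex

variable {n : ℕ} {op : SymConvex n → SymConvex n → SymConvex n}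

theorem isMinkowskiAddition_iff : IsMinkowskiAddition op ↔ ∀ K L, op K L = K.add L :=
  forall₂_congr fun K L => (Subtype.ext_iff (a1 := op K L) (a2 := K.add L)).symm

theorem IsTrivialOrMinkowski.opAssociative (h : IsTrivialOrMinkowski op) : OpAssociative op := by
  intro K L M
  rcases h with h | h | h | h
  · simp only [h]
  · simp only [h]
  · simp only [h]
  · simp only [isMinkowskiAddition_iff.1 h, SymConvex.add_assoc]

theorem IsTrivialOrMinkowski.opHomogeneous (h : IsTrivialOrMinkowski op) : OpHomogeneous op := by
  intro r hr K L
  rcases h with h | h | h | h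
  · simp only [h, scale_origin hr]
  · simp only [h]
  · simp only [h]
  · simp only [isMinkowskiAddition_iff.1 h, scale_add]

/-- Allowing singular `φ` covers projection and `GL(n)` covariance at once. -/
theorem IsTrivialOrMinkowski.image_op (h : IsTrivialOrMinkowski op)
    (φ : EuclideanSpace ℝ (Fin n) →L[ℝ] EuclideanSpace ℝ (Fin n)) (K L : SymConvex n) :
    (op K L).image φ = op (K.image φ) (L.image φ) := by
  rcases h with h | h | h | h
  · simp only [h, image_origin]
  · simp only [h]
  · simp only [h]
  · simp only [isMinkowskiAddition_iff.1 h, image_add]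

/-- The trivial operations are Minkowski sums with `{o}` in place of the ignored arguments. -/
theorem IsTrivialOrMinkowski.opPolynomialVolume (h : IsTrivialOrMinkowski op) :
    OpPolynomialVolume op := by
  intro K L
  rcases h with h | h | h | h
  · obtain ⟨m, a, ha⟩ := exists_volume_add_polynomial (origin : SymConvex n) origin
    refine ⟨m, a, fun r s hr hs => ?_⟩
    rw [h, ← ha r s hr hs, scale_origin hr, scale_origin hs, add_origin]
  · obtain ⟨m, a, ha⟩ := exists_volume_add_polynomial K origin
    refine ⟨m, a, fun r s hr hs => ?_⟩
    rw [h, ← ha r s hr hs, scale_origin hs, add_origin]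
  · obtain ⟨m, a, ha⟩ := exists_volume_add_polynomial origin L
    refine ⟨m, a, fun r s hr hs => ?_⟩
    rw [h, ← ha r s hr hs, scale_origin hr, origin_add]
  · obtain ⟨m, a, ha⟩ := exists_volume_add_polynomial K L
    refine ⟨m, a, fun r s hr hs => ?_⟩
    rw [isMinkowskiAddition_iff.1 h, ha r s hr hs]

theorem IsMinkowskiAddition.opIdentity (h : IsMinkowskiAddition op) : OpIdentity op := fun K => by
  simp only [isMinkowskiAddition_iff.1 h, add_origin, origin_add, and_self]

theorem SymConvex.dist_add_le (K L K' L' : SymConvex n) :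
    dist (K.add L) (K'.add L') ≤ dist K K' + dist L L' := by
  have key : ∀ (K L K' L' : SymConvex n), ∀ x ∈ ((K.add L).1 : Set (EuclideanSpace ℝ (Fin n))),
      ∃ y ∈ ((K'.add L').1 : Set (EuclideanSpace ℝ (Fin n))),
        dist x y ≤ dist K K' + dist L L' := by
    have hex : ∀ (K K' : SymConvex n), ∀ x ∈ K.1, ∃ y ∈ K'.1, dist x y ≤ dist K K' := by
      intro K K' x hx
      obtain ⟨y, hy, hxy⟩ := K'.1.isCompact.exists_infDist_eq_dist K'.1.nonempty x
      exact ⟨y, hy, hxy ▸ Metric.infDist_le_hausdorffDist_of_mem hx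
        ConvexBody.hausdorffEDist_ne_top⟩
    rintro K L K' L' _ ⟨x, hx, y, hy, rfl⟩
    obtain ⟨x', hx', h1⟩ := hex K K' x hx
    obtain ⟨y', hy', h2⟩ := hex L L' y hy
    exact ⟨x' + y', ⟨x', hx', y', hy', rfl⟩, (dist_add_add_le x y x' y').trans (add_le_add h1 h2)⟩
  refine Metric.hausdorffDist_le_of_mem_dist (by positivity) (key K L K' L') ?_
  rw [dist_comm K, dist_comm L]
  exact key K' L' K L

theorem IsMinkowskiAddition.opContinuous (h : IsMinkowskiAddition op) : OpContinuous op := by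
  -- The constant is 2 because the product carries the maximum metric.
  refine LipschitzWith.continuous (K := 2) (LipschitzWith.of_dist_le_mul fun p q => ?_)
  simp only [Function.uncurry, isMinkowskiAddition_iff.1 h]
  refine (dist_add_le _ _ _ _).trans ?_
  rw [Prod.dist_eq, NNReal.coe_ofNat, two_mul]
  exact add_le_add (le_max_left _ _) (le_max_right _ _)

end Converse

/-! ### Polynomial rigidity. -/

section FunctionalEquation

/-- A polynomial function that stays within bounded distance of the identity on `[0, ∞)` is a
translation. -/
theorem Polynomial.eval_eq_add_of_abs_eval_sub_le {p : Polynomial ℝ} {c : ℝ}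
    (h : ∀ r, 0 ≤ r → |p.eval r - r| ≤ c) (r : ℝ) : p.eval r = r + p.eval 0 := by
  have hdeg : (p - Polynomial.X).degree ≤ 0 := by
    rw [← Polynomial.isBoundedUnder_abs_atTop_iff]
    refine Filter.isBoundedUnder_of_eventually_le (a := c) ?_
    filter_upwards [Filter.eventually_ge_atTop 0] with r hr
    simpa using h r hr
  have h1 := Polynomial.eq_C_of_degree_le_zero hdeg
  have h2 := congrArg (Polynomial.eval r) h1
  have h3 := congrArg (Polynomial.eval 0) h1
  simp only [Polynomial.eval_sub, Polynomial.eval_X, Polynomial.eval_C] at h2 h3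
  linarith

/-- For fixed `r, s`, comparing `g (t * r) (t * s)` with `t * g r s` as polynomials in `t` leaves
only the terms with `i + j = 1`. -/
theorem eq_linear_of_polynomial_of_homogeneous {g : ℝ → ℝ → ℝ} {m : ℕ} {a : ℕ → ℕ → ℝ}
    (hg : ∀ c r s : ℝ, 0 ≤ c → 0 ≤ r → 0 ≤ s → g (c * r) (c * s) = c * g r s)
    (hpoly : ∀ r s : ℝ, 0 ≤ r → 0 ≤ s →
      g r s = ∑ i ∈ Finset.range (m + 1), ∑ j ∈ Finset.range (m + 1), a i j * r ^ i * s ^ j)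
    {r s : ℝ} (hr : 0 ≤ r) (hs : 0 ≤ s) : g r s = g 1 0 * r + g 0 1 * s := by
  have key : ∀ r s : ℝ, 0 ≤ r → 0 ≤ s → g r s = ∑ i ∈ Finset.range (m + 1),
      ∑ j ∈ Finset.range (m + 1), if 1 = i + j then a i j * r ^ i * s ^ j else 0 := by
    intro r s hr hs
    let p : Polynomial ℝ := ∑ i ∈ Finset.range (m + 1), ∑ j ∈ Finset.range (m + 1),
      Polynomial.C (a i j * r ^ i * s ^ j) * Polynomial.X ^ (i + j)
    have hp : p = Polynomial.C (g r s) * Polynomial.X := by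
      refine Polynomial.eq_of_infinite_eval_eq _ _ ((Set.Ici_infinite (0 : ℝ)).mono fun t ht => ?_)
      have ht : 0 ≤ t := ht
      have := hg t r s ht hr hs
      rw [hpoly _ _ (mul_nonneg ht hr) (mul_nonneg ht hs)] at this
      simp only [p, Set.mem_ofPred_eq, Polynomial.eval_finsetSum, Polynomial.eval_mul,
        Polynomial.eval_C, Polynomial.eval_pow, Polynomial.eval_X]
      rw [mul_comm (g r s), ← this]
      refine Finset.sum_congr rfl fun i _ => Finset.sum_congr rfl fun j _ => ?_
      ring
    have := congrArg (fun q => Polynomial.coeff q 1) hp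
    simp only [p, Polynomial.finsetSum_coeff, Polynomial.coeff_C_mul, Polynomial.coeff_X_pow,
      Polynomial.coeff_X_one, mul_ite, mul_one, mul_zero] at this
    exact this.symm
  rw [key r s hr hs, key 1 0 zero_le_one le_rfl, key 0 1 le_rfl zero_le_one]
  simp only [Finset.sum_mul, ← Finset.sum_add_distrib]
  refine Finset.sum_congr rfl fun i _ => Finset.sum_congr rfl fun j _ => ?_
  split_ifs with hij
  · obtain ⟨rfl, rfl⟩ | ⟨rfl, rfl⟩ : i = 0 ∧ j = 1 ∨ i = 1 ∧ j = 0 := by omega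
    · simp
    · simp
  · simp

end FunctionalEquation

/-! ### Operations given by a function of the support values. -/

section Represented

open SymConvex

variable {n : ℕ} {op : SymConvex n → SymConvex n → SymConvex n}

/-- The support function of `op K L` is `f` applied to those of `K` and `L`, where `f` is
positively homogeneous of degree 1. -/
structure IsRepresentedBy (op : SymConvex n → SymConvex n → SymConvex n) (f : ℝ → ℝ → ℝ) :
    Prop where
  map_mul : ∀ c a b : ℝ, 0 ≤ c → 0 ≤ a → 0 ≤ b → f (c * a) (c * b) = c * f a b
  supp_op : ∀ K L x, (op K L).supp x = f (K.supp x) (L.supp x)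

theorem isTrivialOrMinkowski_of_supp_op {α β : ℝ} (hα : α = 0 ∨ α = 1) (hβ : β = 0 ∨ β = 1)
    (h : ∀ K L x, (op K L).supp x = α * K.supp x + β * L.supp x) : IsTrivialOrMinkowski op := by
  rcases hα with rfl | rfl <;> rcases hβ with rfl | rfl
  · exact Or.inl fun K L => eq_of_supp_eq fun x => by simp [h]
  · exact Or.inr (Or.inr (Or.inl fun K L => eq_of_supp_eq fun x => by simp [h]))
  · exact Or.inr (Or.inl fun K L => eq_of_supp_eq fun x => by simp [h])
  · exact Or.inr (Or.inr (Or.inr (isMinkowskiAddition_iff.2 fun K L => eq_of_supp_eq fun x => by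
      simp [h, supp_add])))

/-- Segments realise every nonnegative support value, so properties of `op` pass to `f`. -/
theorem SymConvex.supp_seg_smul_self {u : EuclideanSpace ℝ (Fin n)} (hu : ‖u‖ = 1) {a : ℝ}
    (ha : 0 ≤ a) : (seg (a • u)).supp u = a := by
  rw [supp_seg, real_inner_smul_left, real_inner_self_eq_norm_sq, hu]
  simpa using ha

namespace IsRepresentedBy

variable {f : ℝ → ℝ → ℝ}

theorem map_zero_zero (hf : IsRepresentedBy op f) : f 0 0 = 0 := by
  simpa using hf.map_mul 0 0 0 le_rfl le_rfl le_rfl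

theorem nonneg (hf : IsRepresentedBy op f) {u : EuclideanSpace ℝ (Fin n)} (hu : ‖u‖ = 1) {a b : ℝ}
    (ha : 0 ≤ a) (hb : 0 ≤ b) : 0 ≤ f a b := by
  have := (op (seg (a • u)) (seg (b • u))).supp_nonneg u
  rwa [hf.supp_op, supp_seg_smul_self hu ha, supp_seg_smul_self hu hb] at this

theorem assoc (hf : IsRepresentedBy op f) (hop : OpAssociative op)
    {u : EuclideanSpace ℝ (Fin n)} (hu : ‖u‖ = 1) {a b c : ℝ} (ha : 0 ≤ a) (hb : 0 ≤ b)
    (hc : 0 ≤ c) : f a (f b c) = f (f a b) c := by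
  have := congrArg (fun K => K.supp u) (hop (seg (a • u)) (seg (b • u)) (seg (c • u)))
  simpa only [hf.supp_op, supp_seg_smul_self hu ha, supp_seg_smul_self hu hb,
    supp_seg_smul_self hu hc] using this

theorem map_left (hf : IsRepresentedBy op f) {a : ℝ} (ha : 0 ≤ a) : f a 0 = f 1 0 * a := by
  simpa [mul_comm] using hf.map_mul a 1 0 ha zero_le_one le_rfl

theorem map_right (hf : IsRepresentedBy op f) {b : ℝ} (hb : 0 ≤ b) : f 0 b = f 0 1 * b := by
  simpa [mul_comm] using hf.map_mul b 0 1 hb le_rfl zero_le_one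

theorem map_one_zero (hf : IsRepresentedBy op f) (hop : OpAssociative op)
    {u : EuclideanSpace ℝ (Fin n)} (hu : ‖u‖ = 1) : f 1 0 = 0 ∨ f 1 0 = 1 := by
  have := hf.assoc hop hu zero_le_one le_rfl (le_refl (0 : ℝ))
  rw [hf.map_zero_zero, hf.map_left (hf.nonneg hu zero_le_one le_rfl)] at this
  rcases eq_or_ne (f 1 0) 0 with h | h
  · exact Or.inl h
  · exact Or.inr (mul_left_cancel₀ h (by linarith))

theorem map_zero_one (hf : IsRepresentedBy op f) (hop : OpAssociative op)
    {u : EuclideanSpace ℝ (Fin n)} (hu : ‖u‖ = 1) : f 0 1 = 0 ∨ f 0 1 = 1 := by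
  have := hf.assoc hop hu le_rfl (le_refl (0 : ℝ)) zero_le_one
  rw [hf.map_zero_zero, hf.map_right (hf.nonneg hu le_rfl zero_le_one)] at this
  rcases eq_or_ne (f 0 1) 0 with h | h
  · exact Or.inl h
  · exact Or.inr (mul_left_cancel₀ h (by linarith))

theorem isTrivialOrMinkowski_of_linear (hf : IsRepresentedBy op f) (hop : OpAssociative op)
    {u : EuclideanSpace ℝ (Fin n)} (hu : ‖u‖ = 1)
    (hlin : ∀ a b, 0 ≤ a → 0 ≤ b → f a b = f 1 0 * a + f 0 1 * b) : IsTrivialOrMinkowski op :=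
  isTrivialOrMinkowski_of_supp_op (hf.map_one_zero hop hu) (hf.map_zero_one hop hu) fun K L x => by
    rw [hf.supp_op, hlin _ _ (K.supp_nonneg x) (L.supp_nonneg x)]

end IsRepresentedBy

theorem SymConvex.volume_real_pos {K : SymConvex n} {c : ℝ} (hc : 0 < c)
    (h : ∀ x, c * ‖x‖ ≤ K.supp x) :
    0 < volume.real (K.1 : Set (EuclideanSpace ℝ (Fin n))) := by
  have hsub : Metric.ball 0 c ⊆ (K.1 : Set (EuclideanSpace ℝ (Fin n))) := fun p hp =>
    mem_of_forall_inner_le_supportFn K.1.convex K.1.isCompact K.1.nonempty fun x => by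
      refine (real_inner_le_norm x p).trans (le_trans ?_ (h x))
      rw [mul_comm]
      exact mul_le_mul_of_nonneg_right (mem_ball_zero_iff.1 hp).le (norm_nonneg x)
  exact ENNReal.toReal_pos ((Metric.measure_ball_pos volume 0 hc).trans_le
    (measure_mono hsub)).ne' K.1.isCompact.measure_lt_top.ne

end Represented

/-! ### Dimension one. -/

section DimensionOne

open SymConvex

variable {op : SymConvex 1 → SymConvex 1 → SymConvex 1}

theorem isTrivialOrMinkowski_of_opHomogeneous (hhom : OpHomogeneous op) (hass : OpAssociative op)
    (hvol : OpPolynomialVolume op) : IsTrivialOrMinkowski op := by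
  set e : EuclideanSpace ℝ (Fin 1) := EuclideanSpace.single 0 1 with he_def
  have he : ‖e‖ = 1 := by simp [he_def]
  have hx : ∀ x : EuclideanSpace ℝ (Fin 1), x = inner ℝ e x • e := fun x => by
    ext i
    fin_cases i
    simp [he_def, EuclideanSpace.inner_single_left]
  have hsupp : ∀ (K : SymConvex 1) x, K.supp x = |inner ℝ e x| * K.supp e := fun K x => by
    nth_rewrite 1 [hx x]
    rw [supp_smul]
  have heq : ∀ {K L : SymConvex 1}, K.supp e = L.supp e → K = L := fun h =>
    eq_of_supp_eq fun x => by rw [hsupp _ x, hsupp _ x, h]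
  have hseg : ∀ K : SymConvex 1, seg (K.supp e • e) = K := fun K =>
    heq (supp_seg_smul_self he (K.supp_nonneg e))
  have hf : IsRepresentedBy op fun a b => (op (seg (a • e)) (seg (b • e))).supp e := by
    have hmul : ∀ c a b : ℝ, 0 ≤ c → 0 ≤ a → 0 ≤ b →
        (op (seg ((c * a) • e)) (seg ((c * b) • e))).supp e =
          c * (op (seg (a • e)) (seg (b • e))).supp e := by
      intro c a b hc ha hb
      have h : ∀ a : ℝ, 0 ≤ a → seg ((c * a) • e) = (seg (a • e)).scale c := fun a ha => heq (by
        rw [supp_scale hc, supp_seg_smul_self he (mul_nonneg hc ha), supp_seg_smul_self he ha])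
      rw [h a ha, h b hb, hhom c hc, supp_scale hc]
    refine ⟨hmul, fun K L x => ?_⟩
    rw [hsupp (op K L), hsupp K x, hsupp L x,
      hmul _ _ _ (abs_nonneg _) (K.supp_nonneg e) (L.supp_nonneg e), hseg, hseg]
  set f : ℝ → ℝ → ℝ := fun a b => (op (seg (a • e)) (seg (b • e))).supp e
  set V := volume.real ((seg e).1 : Set (EuclideanSpace ℝ (Fin 1))) with hV
  have hVpos : 0 < V := volume_real_pos one_pos fun x => by
    rw [supp_seg, one_mul]
    nth_rewrite 1 [hx x]
    rw [norm_smul, he, mul_one, Real.norm_eq_abs]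
  obtain ⟨m, a, ha⟩ := hvol (seg e) (seg e)
  have hone : (seg e).supp e = 1 := by simpa using supp_seg_smul_self he zero_le_one
  have hfV : ∀ r s : ℝ, 0 ≤ r → 0 ≤ s → f r s * V =
      ∑ i ∈ Finset.range (m + 1), ∑ j ∈ Finset.range (m + 1), a i j * r ^ i * s ^ j := by
    intro r s hr hs
    have h0 := hf.nonneg he hr hs
    -- The product of two scaled copies of `[-e, e]` is the copy scaled by `f r s`, with volume `f r
    -- s * V`.
    have : op ((seg e).scale r) ((seg e).scale s) = (seg e).scale (f r s) := heq (by
      rw [hf.supp_op, supp_scale hr, supp_scale hs, supp_scale h0, hone, mul_one, mul_one, mul_one])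
    rw [← ha r s hr hs, this, hV]
    change _ = volume.real (f r s • ((seg e).1 : Set (EuclideanSpace ℝ (Fin 1))))
    rw [measureReal_def, measureReal_def, Measure.addHaar_smul_of_nonneg _ h0,
      ENNReal.toReal_mul, ENNReal.toReal_ofReal (by positivity)]
    simp
  refine hf.isTrivialOrMinkowski_of_linear hass he fun r s hr hs => ?_
  refine mul_right_cancel₀ hVpos.ne' ?_
  have := eq_linear_of_polynomial_of_homogeneous (g := fun r s => f r s * V)
    (fun c r s hc hr hs => by simp only [hf.map_mul c r s hc hr hs, mul_assoc]) hfV hr hs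
  linarith

end DimensionOne

/-! ### Dimension at least two. -/

section ProjectionCovariant

open SymConvex

variable {n : ℕ} {op : SymConvex n → SymConvex n → SymConvex n}

theorem EuclideanSpace.exists_unit_orthogonal (hn : 2 ≤ n) (u : EuclideanSpace ℝ (Fin n)) :
    ∃ w : EuclideanSpace ℝ (Fin n), ‖w‖ = 1 ∧ inner ℝ u w = 0 := by
  have hne : (Submodule.span ℝ {u})ᗮ ≠ ⊥ := fun h => by
    rw [Submodule.orthogonal_eq_bot_iff] at h
    have := finrank_span_le_card (R := ℝ) ({u} : Set (EuclideanSpace ℝ (Fin n)))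
    rw [h, finrank_top, finrank_euclideanSpace_fin] at this
    simp at this
    omega
  obtain ⟨w, hw, hw0⟩ := Submodule.exists_mem_ne_zero_of_ne_bot hne
  refine ⟨‖w‖⁻¹ • w, ?_, ?_⟩
  · rw [norm_smul, norm_inv, norm_norm, inv_mul_cancel₀ (norm_ne_zero_iff.2 hw0)]
  · rw [real_inner_smul_right, Submodule.mem_orthogonal_singleton_iff_inner_right.1 hw, mul_zero]

theorem SymConvex.proj_span_singleton {u : EuclideanSpace ℝ (Fin n)} (hu : ‖u‖ = 1)
    (K : SymConvex n) : K.proj (Submodule.span ℝ {u}) = seg (K.supp u • u) :=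
  eq_of_supp_eq fun x => by
    rw [supp_proj, Submodule.starProjection_unit_singleton ℝ hu, supp_smul, supp_seg,
      real_inner_smul_left, abs_mul, abs_of_nonneg (K.supp_nonneg u), mul_comm]

/-- The action of `op` on segments in the direction `u`. -/
noncomputable def lineOp (op : SymConvex n → SymConvex n → SymConvex n)
    (u : EuclideanSpace ℝ (Fin n)) (a b : ℝ) : ℝ :=
  (op (seg (a • u)) (seg (b • u))).supp u

theorem OpProjectionCovariant.op_proj_span (hop : OpProjectionCovariant op) (hn : 2 ≤ n)
    {u : EuclideanSpace ℝ (Fin n)} (hu : ‖u‖ = 1) (K L : SymConvex n) :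
    seg ((op K L).supp u • u) = op (seg (K.supp u • u)) (seg (L.supp u • u)) := by
  have h1 : Module.finrank ℝ (Submodule.span ℝ {u}) = 1 :=
    finrank_span_singleton (norm_ne_zero_iff.1 (by rw [hu]; exact one_ne_zero))
  rw [← proj_span_singleton hu, ← proj_span_singleton hu, ← proj_span_singleton hu]
  exact hop _ h1.ge (by omega) K L

theorem OpProjectionCovariant.supp_op (hop : OpProjectionCovariant op) (hn : 2 ≤ n)
    {u : EuclideanSpace ℝ (Fin n)} (hu : ‖u‖ = 1) (K L : SymConvex n) :
    (op K L).supp u = lineOp op u (K.supp u) (L.supp u) := by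
  rw [lineOp, ← hop.op_proj_span hn hu, supp_seg_smul_self hu (supp_nonneg _ u)]

/-- Projecting from the line of `u` to that of `v` multiplies lengths by `|⟨u, v⟩|`. -/
theorem OpProjectionCovariant.lineOp_abs_inner_mul (hop : OpProjectionCovariant op) (hn : 2 ≤ n)
    {u v : EuclideanSpace ℝ (Fin n)} (hu : ‖u‖ = 1) (hv : ‖v‖ = 1) {a b : ℝ} (ha : 0 ≤ a)
    (hb : 0 ≤ b) : lineOp op v (|inner ℝ u v| * a) (|inner ℝ u v| * b) =
      |inner ℝ u v| * lineOp op u a b := by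
  have hseg : ∀ {a : ℝ}, 0 ≤ a → (seg (a • u)).supp v = |inner ℝ u v| * a := fun ha => by
    rw [supp_seg, real_inner_smul_left, abs_mul, abs_of_nonneg ha, mul_comm]
  have h1 := hop.op_proj_span hn hu (seg (a • u)) (seg (b • u))
  rw [supp_seg_smul_self hu ha, supp_seg_smul_self hu hb] at h1
  rw [← hseg ha, ← hseg hb, ← hop.supp_op hn hv, ← h1, hseg (supp_nonneg _ u), lineOp]

/-- Project to a line at angle `arccos √c` and back: lengths shrink by `c` in total. -/
theorem OpProjectionCovariant.lineOp_mul_of_le_one (hop : OpProjectionCovariant op) (hn : 2 ≤ n)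
    {u : EuclideanSpace ℝ (Fin n)} (hu : ‖u‖ = 1) {c a b : ℝ} (hc : 0 ≤ c) (hc1 : c ≤ 1)
    (ha : 0 ≤ a) (hb : 0 ≤ b) : lineOp op u (c * a) (c * b) = c * lineOp op u a b := by
  obtain ⟨w, hw, huw⟩ := EuclideanSpace.exists_unit_orthogonal hn u
  set v := √c • u + √(1 - c) • w with hv_def
  have huv : inner ℝ u v = √c := by
    rw [hv_def, inner_add_right, real_inner_smul_right, real_inner_smul_right, huw,
      real_inner_self_eq_norm_sq, hu]
    ring
  have hv : ‖v‖ = 1 := by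
    have : ‖v‖ ^ 2 = 1 := by
      rw [hv_def, norm_add_sq_real, real_inner_smul_left, real_inner_smul_right, huw, norm_smul,
        norm_smul, hu, hw, Real.norm_eq_abs, Real.norm_eq_abs, mul_one, mul_one, sq_abs, sq_abs,
        Real.sq_sqrt hc, Real.sq_sqrt (sub_nonneg.2 hc1)]
      ring
    exact (pow_eq_one_iff_of_nonneg (norm_nonneg v) two_ne_zero).1 this
  have h1 := hop.lineOp_abs_inner_mul hn hu hv ha hb
  have h2 := hop.lineOp_abs_inner_mul hn hv hu (mul_nonneg (abs_nonneg (inner ℝ u v)) ha)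
    (mul_nonneg (abs_nonneg (inner ℝ u v)) hb)
  rw [h1, real_inner_comm, huv, abs_of_nonneg (Real.sqrt_nonneg c), ← mul_assoc, ← mul_assoc,
    ← mul_assoc, Real.mul_self_sqrt hc] at h2
  exact h2

theorem OpProjectionCovariant.lineOp_mul (hop : OpProjectionCovariant op) (hn : 2 ≤ n)
    {u : EuclideanSpace ℝ (Fin n)} (hu : ‖u‖ = 1) {c a b : ℝ} (hc : 0 ≤ c)
    (ha : 0 ≤ a) (hb : 0 ≤ b) : lineOp op u (c * a) (c * b) = c * lineOp op u a b := by
  rcases le_total c 1 with hc1 | hc1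
  · exact hop.lineOp_mul_of_le_one hn hu hc hc1 ha hb
  · have hc0 : c ≠ 0 := by linarith
    have h := hop.lineOp_mul_of_le_one hn hu (inv_nonneg.2 hc) (inv_le_one_of_one_le₀ hc1)
      (mul_nonneg hc ha) (mul_nonneg hc hb)
    rw [inv_mul_cancel_left₀ hc0, inv_mul_cancel_left₀ hc0] at h
    rw [h, mul_inv_cancel_left₀ hc0]

theorem OpProjectionCovariant.lineOp_eq (hop : OpProjectionCovariant op) (hn : 2 ≤ n)
    {u v : EuclideanSpace ℝ (Fin n)} (hu : ‖u‖ = 1) (hv : ‖v‖ = 1) {a b : ℝ} (ha : 0 ≤ a)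
    (hb : 0 ≤ b) : lineOp op v a b = lineOp op u a b := by
  have key : ∀ {u v : EuclideanSpace ℝ (Fin n)}, ‖u‖ = 1 → ‖v‖ = 1 → inner ℝ u v ≠ 0 →
      lineOp op v a b = lineOp op u a b := fun {u v} hu hv huv => by
    have := hop.lineOp_abs_inner_mul hn hu hv ha hb
    rw [hop.lineOp_mul hn hv (abs_nonneg _) ha hb] at this
    exact mul_left_cancel₀ (abs_ne_zero.2 huv) this
  by_cases huv : inner ℝ u v = 0
  -- For orthogonal directions, pass through the bisector.
  · set w := (√2)⁻¹ • (u + v) with hw_def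
    have hw : ‖w‖ = 1 := by
      have h3 : ‖u + v‖ ^ 2 = 2 := by
        rw [norm_add_sq_real, huv, hu, hv]
        norm_num
      rw [hw_def, norm_smul, norm_inv, Real.norm_of_nonneg (Real.sqrt_nonneg 2), ← h3,
        Real.sqrt_sq (norm_nonneg _), inv_mul_cancel₀]
      intro h
      rw [h] at h3
      norm_num at h3
    have h1 : inner ℝ u w ≠ 0 := by
      rw [hw_def, real_inner_smul_right, inner_add_right, huv, real_inner_self_eq_norm_sq, hu]
      simp
    have h3 : inner ℝ w v ≠ 0 := by
      rw [hw_def, real_inner_smul_left, inner_add_left, huv, real_inner_self_eq_norm_sq, hv]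
      simp
    rw [key hw hv h3, key hu hw h1]
  · exact key hu hv huv

theorem OpProjectionCovariant.isRepresentedBy (hop : OpProjectionCovariant op) (hn : 2 ≤ n)
    {u : EuclideanSpace ℝ (Fin n)} (hu : ‖u‖ = 1) : IsRepresentedBy op (lineOp op u) := by
  refine ⟨fun c a b hc ha hb => hop.lineOp_mul hn hu hc ha hb, fun K L x => ?_⟩
  rcases eq_or_ne x 0 with rfl | hx
  · have h0 : ∀ K : SymConvex n, K.supp 0 = 0 := fun K => by simpa using K.supp_smul 0 0
    have := hop.lineOp_mul hn hu (le_refl 0) (le_refl 0) (le_refl 0)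
    rw [h0, h0, h0]
    simpa using this.symm
  · have hx1 : ‖‖x‖⁻¹ • x‖ = 1 := by
      rw [norm_smul, norm_inv, norm_norm, inv_mul_cancel₀ (norm_ne_zero_iff.2 hx)]
    have hsm : ∀ K : SymConvex n, K.supp x = ‖x‖ * K.supp (‖x‖⁻¹ • x) := fun K => by
      rw [← supp_smul_of_nonneg _ (norm_nonneg x), smul_inv_smul₀ (norm_ne_zero_iff.2 hx)]
    rw [hsm (op K L), hsm K, hsm L,
      hop.lineOp_mul hn hu (norm_nonneg x) (supp_nonneg _ _) (supp_nonneg _ _),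
      hop.supp_op hn hx1, hop.lineOp_eq hn hu hx1 (supp_nonneg _ _) (supp_nonneg _ _)]

namespace IsRepresentedBy

variable {f : ℝ → ℝ → ℝ}

/-- For orthonormal `u, w`, the support function of `[-u,u] * [-w,w]` at `s u + t w` is `f |s| |t|`.
The bounds are its subadditivity, the lower ones after reflecting one coordinate. -/
theorem bounds (hf : IsRepresentedBy op f) (hn : 2 ≤ n) {a b : ℝ} (ha : 0 ≤ a) (hb : 0 ≤ b) :
    f a 0 ≤ f a b ∧ f 0 b ≤ f a b ∧ f a b ≤ f a 0 + f 0 b := by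
  obtain ⟨u, hu, -⟩ := EuclideanSpace.exists_unit_orthogonal hn 0
  obtain ⟨w, hw, huw⟩ := EuclideanSpace.exists_unit_orthogonal hn u
  have hH : ∀ s t : ℝ, (op (seg u) (seg w)).supp (s • u + t • w) = f |s| |t| := fun s t => by
    rw [hf.supp_op, supp_seg, supp_seg, inner_add_right, inner_add_right, real_inner_smul_right,
      real_inner_smul_right, real_inner_smul_right, real_inner_smul_right, huw,
      real_inner_comm u w, huw, real_inner_self_eq_norm_sq, real_inner_self_eq_norm_sq, hu, hw]
    simp
  have h1 := (op (seg u) (seg w)).supp_add_le (a • u + b • w) (a • u + (-b) • w)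
  have h2 := (op (seg u) (seg w)).supp_add_le (a • u + b • w) ((-a) • u + b • w)
  have h3 := (op (seg u) (seg w)).supp_add_le (a • u + (0 : ℝ) • w) ((0 : ℝ) • u + b • w)
  rw [show a • u + b • w + (a • u + (-b) • w) = (2 * a) • u + (0 : ℝ) • w by module] at h1
  rw [show a • u + b • w + ((-a) • u + b • w) = (0 : ℝ) • u + (2 * b) • w by module] at h2
  rw [show a • u + (0 : ℝ) • w + ((0 : ℝ) • u + b • w) = a • u + b • w by module] at h3
  have h4 := hf.map_mul 2 a 0 zero_le_two ha le_rfl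
  have h5 := hf.map_mul 2 0 b zero_le_two le_rfl hb
  simp only [hH, abs_neg, abs_mul, abs_of_nonneg ha, abs_of_nonneg hb, Nat.abs_ofNat, abs_zero,
    mul_zero] at h1 h2 h3 h4 h5
  refine ⟨by linarith, by linarith, h3⟩

/-- For `L = [-e, e] * (B | eᗮ)`, associativity makes `r[-e, e] * L` the image of `L` under the
dilatation by the factor `f r 1` along `e`. -/
theorem exists_polynomial_apply_one (hf : IsRepresentedBy op f) (hn : 2 ≤ n)
    (hass : OpAssociative op) (hvol : OpPolynomialVolume op) (h10 : f 1 0 = 1) (h01 : f 0 1 = 1) :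
    ∃ p : Polynomial ℝ, ∀ r, 0 ≤ r → f r 1 = p.eval r := by
  obtain ⟨e, he, -⟩ := EuclideanSpace.exists_unit_orthogonal hn 0
  set S := (Submodule.span ℝ {e})ᗮ
  have hS' : ∀ x, S.starProjection x = x - inner ℝ e x • e := fun x => by
    rw [Submodule.starProjection_orthogonal_val, Submodule.starProjection_unit_singleton ℝ he]
  set L := op (seg e) ((unitBall n).proj S) with hL
  have hLs : ∀ x, L.supp x = f |inner ℝ e x| ‖x - inner ℝ e x • e‖ := fun x => by
    rw [hL, hf.supp_op, supp_seg, supp_proj, supp_unitBall, hS']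
  have hVpos : 0 < volume.real (L.1 : Set (EuclideanSpace ℝ (Fin n))) := by
    -- The maximum of `|⟨e, x⟩|` and the norm of the orthogonal part is at least half of `‖x‖`.
    refine volume_real_pos one_half_pos fun x => ?_
    rw [hLs]
    obtain ⟨h1, h2, -⟩ := hf.bounds hn (abs_nonneg (inner ℝ e x)) (norm_nonneg (x - inner ℝ e x • e))
    rw [hf.map_left (abs_nonneg _), h10, one_mul] at h1
    rw [hf.map_right (norm_nonneg _), h01, one_mul] at h2
    have h3 := norm_add_le (inner ℝ e x • e) (x - inner ℝ e x • e)
    rw [add_sub_cancel, norm_smul, he, mul_one, Real.norm_eq_abs] at h3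
    linarith
  obtain ⟨m, a, ha⟩ := hvol (seg e) L
  refine ⟨∑ i ∈ Finset.range (m + 1), ∑ j ∈ Finset.range (m + 1),
    Polynomial.C (a i j / volume.real (L.1 : Set (EuclideanSpace ℝ (Fin n)))) * Polynomial.X ^ i,
    fun r hr => ?_⟩
  have hfr : 0 ≤ f r 1 := hf.nonneg he hr zero_le_one
  let φ : EuclideanSpace ℝ (Fin n) →L[ℝ] EuclideanSpace ℝ (Fin n) :=
    LinearMap.toContinuousLinearMap (LinearMap.transvection (innerₗ _ e) ((f r 1 - 1) • e))
  have hφ : ∀ x, φ x = x + inner ℝ e x • (f r 1 - 1) • e := fun x => rfl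
  have hdet : LinearMap.det (φ : EuclideanSpace ℝ (Fin n) →ₗ[ℝ] EuclideanSpace ℝ (Fin n)) =
      f r 1 := by
    change LinearMap.det (LinearMap.transvection (innerₗ _ e) ((f r 1 - 1) • e)) = _
    rw [LinearMap.transvection.det]
    simp [he]
  have hadj : ContinuousLinearMap.adjoint φ = φ := by
    symm
    rw [ContinuousLinearMap.eq_adjoint_iff]
    intro x y
    simp only [hφ, inner_add_left, inner_add_right, real_inner_smul_left, real_inner_smul_right,
      real_inner_comm x e]
    ring
  have himage : op ((seg e).scale r) (L.scale 1) = L.image φ := by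
    refine eq_of_supp_eq fun x => ?_
    have h1 : L.scale 1 = L := eq_of_supp_eq fun x => by rw [supp_scale zero_le_one, one_mul]
    have h2 : inner ℝ e (φ x) = f r 1 * inner ℝ e x := by
      rw [hφ, inner_add_right, real_inner_smul_right, real_inner_smul_right,
        real_inner_self_eq_norm_sq, he]
      ring
    have h3 : φ x - inner ℝ e (φ x) • e = x - inner ℝ e x • e := by
      rw [h2, hφ]
      module
    -- Regroup as `(r[-e,e] * [-e,e]) * (B | eᗮ)`; the bracket has support function `f r 1 * |⟨e,
    -- x⟩|`.
    rw [supp_image, hadj, hLs (φ x), h3, h2, h1, hL, hass, hf.supp_op, hf.supp_op,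
      supp_scale hr, supp_seg, supp_proj, supp_unitBall, hS', abs_mul, abs_of_nonneg hfr,
      mul_comm (f r 1), ← hf.map_mul _ _ _ (abs_nonneg _) hr zero_le_one, mul_one, mul_comm r]
  have h := ha r 1 hr zero_le_one
  rw [himage] at h
  change volume.real (φ '' (L.1 : Set (EuclideanSpace ℝ (Fin n)))) = _ at h
  rw [measureReal_def, Measure.addHaar_image_continuousLinearMap, hdet, ENNReal.toReal_mul,
    ENNReal.toReal_ofReal (abs_nonneg _), abs_of_nonneg hfr, ← measureReal_def,
    ← eq_div_iff hVpos.ne'] at h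
  rw [h]
  simp only [Polynomial.eval_finsetSum, Polynomial.eval_mul, Polynomial.eval_C,
    Polynomial.eval_pow, Polynomial.eval_X, Finset.sum_div, one_pow, mul_one]
  exact Finset.sum_congr rfl fun i _ => Finset.sum_congr rfl fun j _ => by ring

theorem eq_add (hf : IsRepresentedBy op f) (hn : 2 ≤ n)
    (hass : OpAssociative op) (hvol : OpPolynomialVolume op) (h10 : f 1 0 = 1) (h01 : f 0 1 = 1)
    {a b : ℝ} (ha : 0 ≤ a) (hb : 0 ≤ b) : f a b = a + b := by
  obtain ⟨p, hp⟩ := hf.exists_polynomial_apply_one hn hass hvol h10 h01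
  have h1 : ∀ r, 0 ≤ r → f r 1 = r + 1 := fun r hr => by
    -- By `bounds`, `r ≤ f r 1 ≤ r + 1`; the translation constant is `f 0 1 = 1`.
    rw [hp r hr, Polynomial.eval_eq_add_of_abs_eval_sub_le (c := 1) (fun r hr => ?_) r,
      ← hp 0 le_rfl, h01]
    obtain ⟨h1, -, h2⟩ := hf.bounds hn hr zero_le_one
    rw [hf.map_left hr, h10, one_mul] at h1 h2
    rw [← hp r hr, abs_le]
    constructor <;> linarith
  rcases hb.eq_or_lt with rfl | hb
  · rw [hf.map_left ha, h10]
    ring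
  · have := hf.map_mul b (a / b) 1 hb.le (by positivity) zero_le_one
    rw [mul_div_cancel₀ _ hb.ne', mul_one, h1 _ (by positivity)] at this
    rw [this]
    field_simp

end IsRepresentedBy

theorem OpProjectionCovariant.isTrivialOrMinkowski (hop : OpProjectionCovariant op) (hn : 2 ≤ n)
    (hass : OpAssociative op) (hvol : OpPolynomialVolume op) : IsTrivialOrMinkowski op := by
  obtain ⟨u, hu, -⟩ := EuclideanSpace.exists_unit_orthogonal hn 0
  have hf := hop.isRepresentedBy hn hu
  set f := lineOp op u
  refine hf.isTrivialOrMinkowski_of_linear hass hu fun a b ha hb => ?_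
  obtain ⟨h1, h2, h3⟩ := hf.bounds hn ha hb
  -- With 0 in the middle, associativity reads `f a (f 0 b) = f (f a 0) b`, which settles the two
  -- cases where exactly one constant is 1.
  have hab := hf.assoc hass hu ha le_rfl hb
  rw [hf.map_left ha, hf.map_right hb] at h3 hab
  rcases hf.map_one_zero hass hu with hα | hα <;> rcases hf.map_zero_one hass hu with hβ | hβ <;>
    rw [hα, hβ] at h3 hab ⊢
  · linarith [hf.nonneg hu ha hb]
  · rw [zero_mul, one_mul, hf.map_right hb, hβ] at hab
    linarith
  · rw [zero_mul, one_mul, hf.map_left ha, hα] at hab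
    linarith
  · rw [hf.eq_add hn hass hvol hα hβ ha hb]
    ring

theorem SymConvex.continuous_image (K : SymConvex n) :
    Continuous fun φ : EuclideanSpace ℝ (Fin n) →L[ℝ] EuclideanSpace ℝ (Fin n) => K.image φ := by
  obtain ⟨R, hR⟩ := K.1.isBounded.exists_norm_le
  have hR0 : 0 ≤ R := (norm_nonneg _).trans (hR 0 K.zero_mem)
  have key : ∀ φ ψ : EuclideanSpace ℝ (Fin n) →L[ℝ] EuclideanSpace ℝ (Fin n), ∀ x ∈ K.1,
      dist (φ x) (ψ x) ≤ R * dist φ ψ := fun φ ψ x hx => by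
    rw [dist_eq_norm, dist_eq_norm, ← sub_apply, mul_comm]
    exact ((φ - ψ).le_opNorm x).trans (mul_le_mul_of_nonneg_left (hR x hx) (norm_nonneg _))
  refine LipschitzWith.continuous (K := ⟨R, hR0⟩) (LipschitzWith.of_dist_le_mul fun φ ψ =>
    Metric.hausdorffDist_le_of_mem_dist (mul_nonneg hR0 dist_nonneg) ?_ ?_)
  · rintro _ ⟨x, hx, rfl⟩
    exact ⟨ψ x, ⟨x, hx, rfl⟩, key φ ψ x hx⟩
  · rintro _ ⟨x, hx, rfl⟩
    refine ⟨φ x, ⟨x, hx, rfl⟩, ?_⟩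
    rw [dist_comm]
    exact key φ ψ x hx

/-- Projections are limits of invertible maps. -/
theorem OpGLCovariant.opProjectionCovariant (hGL : OpGLCovariant op) (hcont : OpContinuous op) :
    OpProjectionCovariant op := by
  intro S _ _ K L
  set φ : ℝ → EuclideanSpace ℝ (Fin n) →L[ℝ] EuclideanSpace ℝ (Fin n) := fun c =>
    S.starProjection + c • ContinuousLinearMap.id ℝ _ with hφ
  have hlim : Filter.Tendsto φ (nhdsWithin 0 (Set.Ioi 0)) (nhds S.starProjection) := by
    have : Continuous φ := by fun_prop
    have h0 : φ 0 = S.starProjection := by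
      ext1 x
      simp [hφ]
    exact h0 ▸ (this.tendsto 0).mono_left nhdsWithin_le_nhds
  have himage : ∀ K : SymConvex n, Filter.Tendsto (fun c => K.image (φ c))
      (nhdsWithin 0 (Set.Ioi 0)) (nhds (K.proj S)) := fun K =>
    (K.continuous_image.tendsto _).comp hlim
  refine tendsto_nhds_unique ((himage (op K L)).congr' ?_)
    ((hcont.tendsto (K.proj S, L.proj S)).comp ((himage K).prodMk_nhds (himage L)))
  filter_upwards [self_mem_nhdsWithin] with c (hc : 0 < c)
  -- The projection is positive semidefinite, so adding `c • id` with `c > 0` makes it definite.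
  have hinj : Function.Injective 
      (φ c : EuclideanSpace ℝ (Fin n) →ₗ[ℝ] EuclideanSpace ℝ (Fin n)) := by
    rw [← LinearMap.ker_eq_bot, LinearMap.ker_eq_bot']
    intro x hx
    have h1 : inner ℝ (S.starProjection x + c • x) x = 0 := by
      have : S.starProjection x + c • x = 0 := by simpa [hφ] using hx
      rw [this, inner_zero_left]
    rw [inner_add_left, real_inner_smul_left, real_inner_self_eq_norm_sq] at h1
    have h2 : 0 ≤ inner ℝ (S.starProjection x) x := S.re_inner_starProjection_nonneg x
    have h3 : ‖x‖ ^ 2 = 0 := by nlinarith [sq_nonneg ‖x‖]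
    simpa using h3
  let ψ := (LinearEquiv.ofInjectiveEndo _ hinj).toContinuousLinearEquiv
  have hψ : (ψ : EuclideanSpace ℝ (Fin n) →L[ℝ] EuclideanSpace ℝ (Fin n)) = φ c := by
    ext1 x
    rfl
  have := hGL ψ K L
  rwa [hψ] at this

theorem isMinkowskiAddition_of_opGLCovariant (hn : 2 ≤ n) (hcont : OpContinuous op)
    (hGL : OpGLCovariant op) (hass : OpAssociative op) (hid : OpIdentity op)
    (hvol : OpPolynomialVolume op) : IsMinkowskiAddition op := by
  have hne : unitBall n ≠ origin := fun h => by
    obtain ⟨u, hu, -⟩ := EuclideanSpace.exists_unit_orthogonal hn 0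
    have := congrArg (fun K => K.supp u) h
    simp [hu] at this
  obtain ⟨h1, h2⟩ := hid (unitBall n)
  rcases (hGL.opProjectionCovariant hcont).isTrivialOrMinkowski hn hass hvol with h | h | h | h
  · exact absurd (h1.symm.trans (h _ _)) hne
  · exact absurd (h2.symm.trans (h _ _)) hne
  · exact absurd (h1.symm.trans (h _ _)) hne
  · exact h

end ProjectionCovariant

theorem corollary10p5 :
    (∀ n : ℕ, 2 ≤ n → ∀ op : SymConvex n → SymConvex n → SymConvex n,
      (OpProjectionCovariant op ∧ OpAssociative op ∧ OpPolynomialVolume op ↔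
        IsTrivialOrMinkowski op)) ∧
    (∀ op : SymConvex 1 → SymConvex 1 → SymConvex 1,
      (OpHomogeneous op ∧ OpAssociative op ∧ OpPolynomialVolume op ↔
        IsTrivialOrMinkowski op)) ∧
    (∀ n : ℕ, 2 ≤ n → ∀ op : SymConvex n → SymConvex n → SymConvex n,
      (OpContinuous op ∧ OpGLCovariant op ∧ OpAssociative op ∧ OpIdentity op ∧
          OpPolynomialVolume op ↔
        IsMinkowskiAddition op)) := by
  refine ⟨fun n hn op => ⟨fun ⟨h1, h2, h3⟩ => h1.isTrivialOrMinkowski hn h2 h3, fun h =>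
      ⟨fun _ _ _ K L => h.image_op _ K L, h.opAssociative, h.opPolynomialVolume⟩⟩,
    fun op => ⟨fun ⟨h1, h2, h3⟩ => isTrivialOrMinkowski_of_opHomogeneous h1 h2 h3, fun h =>
      ⟨h.opHomogeneous, h.opAssociative, h.opPolynomialVolume⟩⟩,
    fun n hn op => ⟨fun ⟨h1, h2, h3, h4, h5⟩ =>
      isMinkowskiAddition_of_opGLCovariant hn h1 h2 h3 h4 h5, fun h => ?_⟩⟩
  have h' : IsTrivialOrMinkowski op := Or.inr (Or.inr (Or.inr h))
  exact ⟨h.opContinuous, fun φ K L => h'.image_op _ K L, h'.opAssociative, h.opIdentity,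
    h'.opPolynomialVolume⟩
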